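/- Let $\Phi:\mathbb{C}[x]\to[0,\infty)$ be a multiplicative distance function, that is: $\Phi$ is continuous as a function of the coefficient vector on every finite-dimensional subspace of $\mathbb{C}[x]$; $\Phi(f)=0$ if and only if $f=0$; $\Phi(wf)=|w|\,\Phi(f)$ and $\Phi(fg)=\Phi(f)\Phi(g)$ for all $w\in\mathbb{C}$ and $f,g\in\mathbb{C}[x]$. Let $\phi(\gamma)=\Phi(x-\gamma)$ for $\gamma\in\mathbb{C}$. Let $N=2J$ be even and let $s\in\mathbb{C}$ with $\operatorname{Re}(s)>N$. Put \[ F_N(\Phi;s)=\int_{\mathbb{R}^N}\Phi\Big(x^N+\sum_{n=1}^N b_n x^{N-n}\Big)^{-s}\,d\lambda_N(\mathbf b), \] where $\lambda_N$ is Lebesgue measure on $\mathbb{R}^N$. For polynomials $P,Q\in\mathbb{C}[x]$ of degree at most $N-1$ put \[ \langle P,Q\rangle=\int_{\mathbb{R}^2}\phi(x)^{-s}\phi(y)^{-s}P(x)Q(y)\,\operatorname{sgn}(y-x)\,dx\,dy -2i\int_{\mathbb{C}}\phi(\beta)^{-s}\phi(\overline\beta)^{-s}P(\overline\beta)Q(\beta)\,\operatorname{sgn}(\operatorname{Im}\beta)\,d\lambda_2(\beta),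 \] where $\lambda_2$ is Lebesgue measure on $\mathbb{C}$. Let $Q_1,\dots,Q_N\in\mathbb{C}[x]$ be monic with $\deg Q_n=n-1$, and suppose that they are skew-orthogonal with normalizations $\mathfrak{M}_1,\dots,\mathfrak{M}_J\in\mathbb{C}$, that is, for all $j,k\in\{1,\dots,J\}$, \[ \langle Q_{2k-1},Q_{2j}\rangle=-\langle Q_{2j},Q_{2k-1}\rangle=\delta_{kj}\,\mathfrak{M}_j,\qquad \langle Q_{2j},Q_{2k}\rangle=\langle Q_{2j-1},Q_{2k-1}\rangle=0 . \] Then the integral defining $F_N(\Phi;s)$ converges absolutely, and \[ F_N(\Phi;s)=\prod_{j=1}^J\mathfrak{M}_j . \] -/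

import Mathlib

open Polynomial MeasureTheory

noncomputable section

/-- A multiplicative distance function on `ℂ[x]`: a function to `[0, ∞)` which is continuous in the
coefficient vector on polynomials of bounded degree (equivalently, on every finite-dimensional
subspace), positive definite, absolutely homogeneous and multiplicative. -/
structure IsMultiplicativeDistanceFunction (Φ : ℂ[X] → ℝ) : Prop where
  nonneg : ∀ f, 0 ≤ Φ f
  continuous_coeff : ∀ n : ℕ,
    Continuous fun c : Fin n → ℂ => Φ (∑ i : Fin n, C (c i) * X ^ (i : ℕ))
  eq_zero_iff : ∀ f, Φ f = 0 ↔ f = 0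
  map_C_mul : ∀ (w : ℂ) (f : ℂ[X]), Φ (C w * f) = ‖w‖ * Φ f
  map_mul : ∀ f g : ℂ[X], Φ (f * g) = Φ f * Φ g

/-- The root function `φ(γ) = Φ(x - γ)`. -/
def rootFunction (Φ : ℂ[X] → ℝ) (γ : ℂ) : ℝ := Φ (X - C γ)

/-- The monic polynomial `x^N + b₁ x^(N-1) + ⋯ + b_N` with real coefficient vector `b`
(the coordinate `b_n` is `b ⟨n - 1, _⟩`). -/
def monicPoly (N : ℕ) (b : Fin N → ℝ) : ℂ[X] :=
  X ^ N + ∑ i : Fin N, C ((b i : ℝ) : ℂ) * X ^ (N - ((i : ℕ) + 1))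

/-- The integrand `Φ̃(b)^(-s)` of the real moment function. -/
def momentIntegrand (Φ : ℂ[X] → ℝ) (N : ℕ) (s : ℂ) (b : Fin N → ℝ) : ℂ :=
  ((Φ (monicPoly N b) : ℝ) : ℂ) ^ (-s)

/-- The degree `N` real moment function `F_N(Φ; s)`. -/
def realMoment (Φ : ℂ[X] → ℝ) (N : ℕ) (s : ℂ) : ℂ :=
  ∫ b : Fin N → ℝ, momentIntegrand Φ N s b

/-- The real skew-symmetric bilinear form `⟨P, Q⟩_ℝ`. -/
def realSkewForm (Φ : ℂ[X] → ℝ) (s : ℂ) (P Q : ℂ[X]) : ℂ :=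
  ∫ p : ℝ × ℝ, ((rootFunction Φ (p.1 : ℂ) : ℝ) : ℂ) ^ (-s) *
    ((rootFunction Φ (p.2 : ℂ) : ℝ) : ℂ) ^ (-s) *
    P.eval (p.1 : ℂ) * Q.eval (p.2 : ℂ) * ((Real.sign (p.2 - p.1) : ℝ) : ℂ)

/-- The complex skew-symmetric bilinear form `⟨P, Q⟩_ℂ`. -/
def complexSkewForm (Φ : ℂ[X] → ℝ) (s : ℂ) (P Q : ℂ[X]) : ℂ :=
  -2 * Complex.I * ∫ β : ℂ, ((rootFunction Φ β : ℝ) : ℂ) ^ (-s) *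
    ((rootFunction Φ (starRingEnd ℂ β) : ℝ) : ℂ) ^ (-s) *
    P.eval (starRingEnd ℂ β) * Q.eval β * ((Real.sign β.im : ℝ) : ℂ)

/-- The skew-symmetric bilinear form `⟨P, Q⟩ = ⟨P, Q⟩_ℝ + ⟨P, Q⟩_ℂ`. -/
def skewForm (Φ : ℂ[X] → ℝ) (s : ℂ) (P Q : ℂ[X]) : ℂ :=
  realSkewForm Φ s P Q + complexSkewForm Φ s P Q

/-- A complete family of `N` monic polynomials. With indices counted from `0`, the `n`-th member
has degree `n`. -/
def IsCompleteMonicFamily {N : ℕ} (Q : Fin N → ℂ[X]) : Prop :=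
  ∀ n : Fin N, (Q n).Monic ∧ (Q n).natDegree = (n : ℕ)

/-- Position of the first member `Q_{2j-1}` (one-based) of the `j`-th pair. -/
def pairFst {J : ℕ} (j : Fin J) : Fin (2 * J) := ⟨2 * (j : ℕ), by omega⟩

/-- Position of the second member `Q_{2j}` (one-based) of the `j`-th pair. -/
def pairSnd {J : ℕ} (j : Fin J) : Fin (2 * J) := ⟨2 * (j : ℕ) + 1, by omega⟩

/-- `Q` is skew-orthogonal with respect to `⟨·,·⟩`, with normalizations `M`. -/
structure IsSkewOrthogonal (Φ : ℂ[X] → ℝ) (s : ℂ) {J : ℕ}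
    (Q : Fin (2 * J) → ℂ[X]) (M : Fin J → ℂ) : Prop where
  fst_snd : ∀ k j : Fin J,
    skewForm Φ s (Q (pairFst k)) (Q (pairSnd j)) = if k = j then M j else 0
  snd_fst : ∀ k j : Fin J,
    -skewForm Φ s (Q (pairSnd j)) (Q (pairFst k)) = if k = j then M j else 0
  snd_snd : ∀ j k : Fin J, skewForm Φ s (Q (pairSnd j)) (Q (pairSnd k)) = 0
  fst_fst : ∀ j k : Fin J, skewForm Φ s (Q (pairFst j)) (Q (pairFst k)) = 0

end

/-!
Identify a monic real polynomial with its vector of lower coefficients. Multiplication of a monic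
quadratic by a monic polynomial of even degree `n` then has Jacobian determinant the resultant of
the two factors. A squarefree real polynomial of degree `n + 2` with `r` real roots and `m` pairs of
conjugate roots has `r.choose 2 + m` monic quadratic factors, and the signs of the corresponding
resultants add up to `(n + 2) / 2`, whatever `r` and `m` are. So the area formula, applied
separately where the resultant is positive and where it is negative, turns the integral of a
function against the resultant into `(n + 2) / 2` times its integral. Iterating, the integral of
`Φ(q₁ ⋯ q_J)^(-s) ∏_{k < l} Res(q_k, q_l)` over `J`-tuples of quadratics is `J! F_N(Φ; s)`.

In terms of the roots `x_k`, `y_k` of `q_k` the product of resultants is the Vandermonde determinant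
divided by `∏ (y_k - x_k)`, and the Vandermonde determinant is the determinant of the values of any
complete family of monic polynomials. Antisymmetrizing in each pair `x_k`, `y_k` makes each term of
the Leibniz expansion a product of functions of one quadratic each. The integral of such a factor is
`⟨P, Q⟩`: quadratics with real roots give the real part, by the substitution `q = (x - a)(x - b)` of
Jacobian `b - a`, and those with conjugate roots give the complex part. For a skew-orthogonal family
the resulting sum is the block-diagonal Pfaffian sum `2^J J! ∏ 𝔐_j`.

All integrals converge because homogeneity, continuity and positivity of `Φ` give
`Φ(f) ≥ c ‖f‖` on polynomials of bounded degree.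
-/

section AreaFormula

open Set Function
open scoped NNReal ENNReal

variable {E : Type*} [NormedAddCommGroup E] [NormedSpace ℝ E] [FiniteDimensional ℝ E]

theorem exists_pos_forall_approximatesLinearOn_injOn (A : E →L[ℝ] E) :
    ∃ δ : ℝ≥0, δ ≠ 0 ∧ (A.det ≠ 0 → ∀ (t : Set E) (g : E → E),
      ApproximatesLinearOn g A t δ → InjOn g t) := by
  by_cases hA : A.det = 0
  · exact ⟨1, one_ne_zero, fun h => absurd hA h⟩
  let A' := A.toContinuousLinearEquivOfDetNeZero hA
  rcases A'.subsingleton_or_nnnorm_symm_pos with hE | hN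
  · exact ⟨1, one_ne_zero, fun _ t g _ x _ y _ _ => Subsingleton.elim x y⟩
  · refine ⟨‖(A'.symm : E →L[ℝ] E)‖₊⁻¹ / 2, by positivity, fun _ t g hg => ?_⟩
    rw [← A.coe_toContinuousLinearEquivOfDetNeZero hA] at hg
    exact hg.injOn (Or.inr (NNReal.half_lt_self (inv_ne_zero hN.ne')))

variable [MeasurableSpace E] [BorelSpace E] {F : E → E} {F' : E → E →L[ℝ] E} {s : Set E}

theorem exists_measurable_partition_injOn (hs : MeasurableSet s)
    (hF : ∀ x ∈ s, HasFDerivWithinAt F (F' x) s x) (hdet : ∀ x ∈ s, (F' x).det ≠ 0) :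
    ∃ A : ℕ → Set E, Pairwise (Disjoint on A) ∧ (∀ i, MeasurableSet (A i)) ∧ ⋃ i, A i = s ∧
      ∀ i, InjOn F (A i) := by
  choose δ hδ hinj using exists_pos_forall_approximatesLinearOn_injOn (E := E)
  obtain ⟨t, L, hdisj, hmeas, hcover, happrox, hL⟩ :=
    exists_partition_approximatesLinearOn_of_hasFDerivWithinAt F s F' hF δ hδ
  refine ⟨fun i => s ∩ t i, fun i j hij => (hdisj hij).mono inter_subset_right inter_subset_right,
    fun i => hs.inter (hmeas i), by rw [← inter_iUnion, inter_eq_left.2 hcover], fun i x hx => ?_⟩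
  obtain ⟨y, hy, hLy⟩ := hL ⟨x, hx.1⟩ i
  exact hinj (L i) (hLy ▸ hdet y hy) _ F (happrox i) hx

theorem count_iUnion_inter_fiber {A : ℕ → Set E} (hF : Measurable F)
    (hdisj : Pairwise (Disjoint on A)) (hmeas : ∀ i, MeasurableSet (A i))
    (hinj : ∀ i, InjOn F (A i)) :
    (fun b => Measure.count ((⋃ i, A i) ∩ F ⁻¹' {b})) =
      ∑' i, (F '' A i).indicator (1 : E → ℝ≥0∞) := by
  ext b
  rw [iUnion_inter, measure_iUnion
    (fun i j hij => (hdisj hij).mono inter_subset_left inter_subset_left)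
    fun i => (hmeas i).inter (hF (measurableSet_singleton b)),
    tsum_apply (Pi.summable.2 fun _ => ENNReal.summable)]
  refine tsum_congr fun i => ?_
  by_cases hb : b ∈ F '' A i
  · obtain ⟨x, hx, rfl⟩ := hb
    have hfib : A i ∩ F ⁻¹' {F x} = {x} :=
      Subset.antisymm (fun y hy => hinj i hy.1 hx hy.2) (singleton_subset_iff.2 ⟨hx, rfl⟩)
    rw [hfib, Measure.count_singleton, indicator_of_mem (mem_image_of_mem F hx), Pi.one_apply]
  · have hfib : A i ∩ F ⁻¹' {b} = ∅ := eq_empty_of_forall_notMem fun x hx => hb ⟨x, hx.1, hx.2⟩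
    rw [hfib, measure_empty, indicator_of_notMem hb]

theorem measurable_count_inter_fiber (hs : MeasurableSet s)
    (hF : ∀ x ∈ s, HasFDerivWithinAt F (F' x) s x) (hdet : ∀ x ∈ s, (F' x).det ≠ 0)
    (hFm : Measurable F) : Measurable fun b => Measure.count (s ∩ F ⁻¹' {b}) := by
  obtain ⟨A, hdisj, hmeas, rfl, hinj⟩ := exists_measurable_partition_injOn hs hF hdet
  rw [count_iUnion_inter_fiber hFm hdisj hmeas hinj]
  exact Measurable.tsum' fun i => measurable_one.indicator <| measurable_image_of_fderivWithin
    (hmeas i) (fun x hx => (hF x (mem_iUnion_of_mem i hx)).mono (subset_iUnion A i)) (hinj i)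

variable {μ : Measure E} {K : ℕ} {G : Type*} [NormedAddCommGroup G] [NormedSpace ℝ G] {f : E → G}

theorem integrable_toReal_count_smul (hs : MeasurableSet s)
    (hF : ∀ x ∈ s, HasFDerivWithinAt F (F' x) s x) (hdet : ∀ x ∈ s, (F' x).det ≠ 0)
    (hFm : Measurable F) (hK : ∀ᵐ b ∂μ, Measure.count (s ∩ F ⁻¹' {b}) ≤ K)
    (hf : Integrable f μ) :
    Integrable (fun b => (Measure.count (s ∩ F ⁻¹' {b})).toReal • f b) μ := by
  refine hf.bdd_smul (K : ℝ)
    (measurable_count_inter_fiber hs hF hdet hFm).ennreal_toReal.aestronglyMeasurable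
    (hK.mono fun b hb => ?_)
  rw [Real.norm_of_nonneg ENNReal.toReal_nonneg]
  exact ENNReal.toReal_le_of_le_ofReal K.cast_nonneg (by simpa using hb)

variable [μ.IsAddHaarMeasure]

variable (μ) in
theorem map_withDensity_abs_det_fderiv_eq_withDensity_count (hs : MeasurableSet s)
    (hF : ∀ x ∈ s, HasFDerivWithinAt F (F' x) s x) (hdet : ∀ x ∈ s, (F' x).det ≠ 0)
    (hFm : Measurable F) :
    ((μ.restrict s).withDensity fun x => ENNReal.ofReal |(F' x).det|).map F =
      μ.withDensity fun b => Measure.count (s ∩ F ⁻¹' {b}) := by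
  obtain ⟨A, hdisj, hmeas, rfl, hinj⟩ := exists_measurable_partition_injOn hs hF hdet
  have hFA : ∀ i, ∀ x ∈ A i, HasFDerivWithinAt F (F' x) (A i) x := fun i x hx =>
    (hF x (mem_iUnion_of_mem i hx)).mono (subset_iUnion A i)
  have himg : ∀ i, MeasurableSet (F '' A i) := fun i =>
    measurable_image_of_fderivWithin (hmeas i) (hFA i) (hinj i)
  rw [count_iUnion_inter_fiber hFm hdisj hmeas hinj,
    withDensity_tsum fun i => measurable_one.indicator (himg i),
    Measure.restrict_iUnion hdisj hmeas, withDensity_sum, Measure.map_sum hFm.aemeasurable]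
  congr 1 with i : 1
  rw [map_withDensity_abs_det_fderiv_eq_addHaar μ (hmeas i).nullMeasurableSet (hFA i) (hinj i),
    withDensity_indicator_one (himg i)]

theorem lintegral_abs_det_fderiv_mul_comp_le (hs : MeasurableSet s)
    (hF : ∀ x ∈ s, HasFDerivWithinAt F (F' x) s x) (hdet : ∀ x ∈ s, (F' x).det ≠ 0)
    (hFm : Measurable F) (hK : ∀ᵐ b ∂μ, Measure.count (s ∩ F ⁻¹' {b}) ≤ K)
    {h : E → ℝ≥0∞} (hh : Measurable h) :
    ∫⁻ x in s, ENNReal.ofReal |(F' x).det| * h (F x) ∂μ ≤ K * ∫⁻ b, h b ∂μ := by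
  calc ∫⁻ x in s, ENNReal.ofReal |(F' x).det| * h (F x) ∂μ
      = ∫⁻ b, h b ∂μ.withDensity fun b => Measure.count (s ∩ F ⁻¹' {b}) := by
        rw [← map_withDensity_abs_det_fderiv_eq_withDensity_count μ hs hF hdet hFm,
          lintegral_map hh hFm]
        exact (lintegral_withDensity_eq_lintegral_mul₀
          (aemeasurable_ofReal_abs_det_fderivWithin μ hs hF) (hh.comp hFm).aemeasurable).symm
    _ ≤ ∫⁻ b, h b ∂μ.withDensity fun _ => (K : ℝ≥0∞) :=
        lintegral_mono' (withDensity_mono hK) le_rfl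
    _ = K * ∫⁻ b, h b ∂μ := by rw [withDensity_const, lintegral_smul_measure, smul_eq_mul]

theorem integrableOn_abs_det_fderiv_smul_comp (hs : MeasurableSet s)
    (hF : ∀ x ∈ s, HasFDerivWithinAt F (F' x) s x) (hdet : ∀ x ∈ s, (F' x).det ≠ 0)
    (hFm : Measurable F) (hK : ∀ᵐ b ∂μ, Measure.count (s ∩ F ⁻¹' {b}) ≤ K)
    (hf : Integrable f μ) : IntegrableOn (fun x => |(F' x).det| • f (F x)) s μ := by
  have hmap := map_withDensity_abs_det_fderiv_eq_withDensity_count μ hs hF hdet hFm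
  have hle : μ.withDensity (fun b => Measure.count (s ∩ F ⁻¹' {b})) ≤ (K : ℝ≥0∞) • μ :=
    withDensity_const (μ := μ) (K : ℝ≥0∞) ▸ withDensity_mono hK
  have hint := (hf.smul_measure (ENNReal.natCast_ne_top K)).mono_measure hle
  rw [← hmap] at hint
  have hcomp := (integrable_map_measure hint.aestronglyMeasurable hFm.aemeasurable).1 hint
  rw [integrable_withDensity_iff_integrable_smul₀'
    (aemeasurable_ofReal_abs_det_fderivWithin μ hs hF)
    (Filter.Eventually.of_forall fun _ => ENNReal.ofReal_lt_top)] at hcomp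
  simpa only [IntegrableOn, ENNReal.toReal_ofReal (abs_nonneg _), comp_apply] using hcomp

theorem setIntegral_abs_det_fderiv_smul_comp (hs : MeasurableSet s)
    (hF : ∀ x ∈ s, HasFDerivWithinAt F (F' x) s x) (hdet : ∀ x ∈ s, (F' x).det ≠ 0)
    (hFm : Measurable F) (hK : ∀ᵐ b ∂μ, Measure.count (s ∩ F ⁻¹' {b}) ≤ K)
    (hf : AEStronglyMeasurable f μ) :
    ∫ x in s, |(F' x).det| • f (F x) ∂μ =
      ∫ b, (Measure.count (s ∩ F ⁻¹' {b})).toReal • f b ∂μ := by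
  have hmap := map_withDensity_abs_det_fderiv_eq_withDensity_count μ hs hF hdet hFm
  have hf' : AEStronglyMeasurable f
      (((μ.restrict s).withDensity fun x => ENNReal.ofReal |(F' x).det|).map F) :=
    hmap ▸ hf.mono_ac (withDensity_absolutelyContinuous _ _)
  rw [← integral_withDensity_eq_integral_toReal_smul₀
      (measurable_count_inter_fiber hs hF hdet hFm).aemeasurable
      (hK.mono fun b hb => hb.trans_lt (ENNReal.natCast_lt_top K)), ← hmap,
    integral_map hFm.aemeasurable hf', integral_withDensity_eq_integral_toReal_smul₀
      (aemeasurable_ofReal_abs_det_fderivWithin μ hs hF)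
      (Filter.Eventually.of_forall fun _ => ENNReal.ofReal_lt_top)]
  simp only [ENNReal.toReal_ofReal (abs_nonneg _)]

end AreaFormula

section SignedAreaFormula

open Set Function
open scoped ENNReal

variable {E : Type*} [NormedAddCommGroup E] [NormedSpace ℝ E] [FiniteDimensional ℝ E]
  [MeasurableSpace E] [BorelSpace E] {F : E → E} {F' : E → E →L[ℝ] E}

/-- The fibre of `F` over `b` has at most `K` points, and the signs of the Jacobian determinants
at these points add up to `c`. -/
def HasSignedFiberCard (F : E → E) (F' : E → E →L[ℝ] E) (K : ℕ) (c : ℝ) (b : E) : Prop :=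
  ∃ S : Finset E, F ⁻¹' {b} = S ∧ S.card ≤ K ∧ ∑ x ∈ S, Real.sign (F' x).det = c

variable {K : ℕ} {c : ℝ} {b : E}

theorem HasSignedFiberCard.count_le (hb : HasSignedFiberCard F F' K c b) (s : Set E) :
    Measure.count (s ∩ F ⁻¹' {b}) ≤ K := by
  obtain ⟨S, hS, hK, -⟩ := hb
  calc Measure.count (s ∩ F ⁻¹' {b}) ≤ Measure.count (S : Set E) :=
        measure_mono (hS ▸ inter_subset_right)
    _ ≤ K := by rw [Measure.count_apply_finset]; exact_mod_cast hK

theorem HasSignedFiberCard.count_sub_count (hb : HasSignedFiberCard F F' K c b) :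
    (Measure.count ({x | 0 < (F' x).det} ∩ F ⁻¹' {b})).toReal -
      (Measure.count ({x | (F' x).det < 0} ∩ F ⁻¹' {b})).toReal = c := by
  classical
  obtain ⟨S, hS, -, hsum⟩ := hb
  have hcount : ∀ p : E → Prop, (Measure.count ({x | p x} ∩ F ⁻¹' {b})).toReal =
      ∑ x ∈ S, if p x then (1 : ℝ) else 0 := by
    intro p
    have hfilter : {x | p x} ∩ F ⁻¹' {b} = (S.filter p : Finset E) := by
      rw [hS, inter_comm, Finset.coe_filter]
      rfl
    rw [hfilter, Measure.count_apply_finset, ENNReal.toReal_natCast, Finset.sum_boole]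
  rw [hcount, hcount, ← hsum, ← Finset.sum_sub_distrib]
  refine Finset.sum_congr rfl fun x _ => ?_
  rcases lt_trichotomy (F' x).det 0 with h | h | h
  · simp [h, h.not_gt, Real.sign_of_neg h]
  · simp [h]
  · simp [h, h.not_gt, Real.sign_of_pos h]

variable {μ : Measure E} [μ.IsAddHaarMeasure]

theorem measurable_det_of_hasFDerivAt (hF : ∀ x, HasFDerivAt F (F' x) x) :
    Measurable fun x => (F' x).det := by
  rw [show F' = fderiv ℝ F from funext fun x => (hF x).fderiv.symm]
  exact ContinuousLinearMap.continuous_det.measurable.comp (measurable_fderiv ℝ F)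

theorem lintegral_enorm_det_mul_comp_le (hF : ∀ x, HasFDerivAt F (F' x) x)
    (hfib : ∀ᵐ b ∂μ, HasSignedFiberCard F F' K c b) {h : E → ℝ≥0∞} (hh : Measurable h) :
    ∫⁻ x, ‖(F' x).det‖ₑ * h (F x) ∂μ ≤ K * ∫⁻ b, h b ∂μ := by
  have hs : MeasurableSet {x | (F' x).det ≠ 0} :=
    measurable_det_of_hasFDerivAt hF (measurableSet_singleton (0 : ℝ)).compl
  calc ∫⁻ x, ‖(F' x).det‖ₑ * h (F x) ∂μ
      = ∫⁻ x in {x | (F' x).det ≠ 0}, ‖(F' x).det‖ₑ * h (F x) ∂μ := by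
        refine (setLIntegral_eq_of_support_subset ?_).symm
        exact fun x hx hdet => hx (by simp only [hdet, enorm_zero, zero_mul])
    _ ≤ K * ∫⁻ b, h b ∂μ := by
        simp only [Real.enorm_eq_ofReal_abs]
        exact lintegral_abs_det_fderiv_mul_comp_le hs (fun x _ => (hF x).hasFDerivWithinAt)
          (fun _ hx => hx) (continuous_iff_continuousAt.2 fun x => (hF x).continuousAt).measurable
          (hfib.mono fun b hb => hb.count_le _) hh

variable {G : Type*} [NormedAddCommGroup G] [NormedSpace ℝ G] {f : E → G}

theorem integral_det_smul_comp (hF : ∀ x, HasFDerivAt F (F' x) x)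
    (hfib : ∀ᵐ b ∂μ, HasSignedFiberCard F F' K c b) (hf : Integrable f μ) :
    Integrable (fun x => (F' x).det • f (F x)) μ ∧
      ∫ x, (F' x).det • f (F x) ∂μ = c • ∫ b, f b ∂μ := by
  have hFm : Measurable F := (continuous_iff_continuousAt.2 fun x => (hF x).continuousAt).measurable
  have hdet := measurable_det_of_hasFDerivAt hF
  set P := {x | 0 < (F' x).det}
  set N := {x | (F' x).det < 0}
  have hP : MeasurableSet P := hdet measurableSet_Ioi
  have hN : MeasurableSet N := hdet measurableSet_Iio
  have hF' : ∀ s : Set E, ∀ x ∈ s, HasFDerivWithinAt F (F' x) s x :=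
    fun s x _ => (hF x).hasFDerivWithinAt
  have hP0 : ∀ x ∈ P, (F' x).det ≠ 0 := fun x hx => ne_of_gt hx
  have hN0 : ∀ x ∈ N, (F' x).det ≠ 0 := fun x hx => ne_of_lt hx
  have hK : ∀ s : Set E, ∀ᵐ b ∂μ, Measure.count (s ∩ F ⁻¹' {b}) ≤ K :=
    fun s => hfib.mono fun b hb => hb.count_le s
  have hPint := integrableOn_abs_det_fderiv_smul_comp hP (hF' P) hP0 hFm (hK P) hf
  have hNint := integrableOn_abs_det_fderiv_smul_comp hN (hF' N) hN0 hFm (hK N) hf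
  have hsplit : (fun x => (F' x).det • f (F x)) =
      fun x => P.indicator (fun x => |(F' x).det| • f (F x)) x -
        N.indicator (fun x => |(F' x).det| • f (F x)) x := by
    ext x
    rcases lt_trichotomy (F' x).det 0 with h | h | h
    · simp [P, N, indicator, h, h.not_gt, abs_of_neg h]
    · simp [P, N, indicator, h]
    · simp [P, N, indicator, h, h.not_gt, abs_of_pos h]
  rw [hsplit]
  refine ⟨(hPint.integrable_indicator hP).sub (hNint.integrable_indicator hN), ?_⟩
  rw [integral_sub (hPint.integrable_indicator hP) (hNint.integrable_indicator hN),
    integral_indicator hP, integral_indicator hN,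
    setIntegral_abs_det_fderiv_smul_comp hP (hF' P) hP0 hFm (hK P) hf.aestronglyMeasurable,
    setIntegral_abs_det_fderiv_smul_comp hN (hF' N) hN0 hFm (hK N) hf.aestronglyMeasurable,
    ← integral_sub (integrable_toReal_count_smul hP (hF' P) hP0 hFm (hK P) hf)
      (integrable_toReal_count_smul hN (hF' N) hN0 hFm (hK N) hf), ← integral_smul]
  refine integral_congr_ae (hfib.mono fun b hb => ?_)
  simp only [← sub_smul, hb.count_sub_count, P, N]

end SignedAreaFormula

section MonicCoordinates

variable {R : Type*} [CommRing R] {m n : ℕ}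

/-- The polynomial of degree less than `n` whose coefficient of `X ^ i` is `c i`. -/
noncomputable def polyOfCoeffs (n : ℕ) : (Fin n → R) →ₗ[R] R[X] where
  toFun c := ∑ i : Fin n, C (c i) * X ^ (i : ℕ)
  map_add' c d := by simp only [Pi.add_apply, C_add, add_mul, Finset.sum_add_distrib]
  map_smul' r c := by
    simp only [Pi.smul_apply, smul_eq_mul, C_mul, mul_assoc, Finset.mul_sum, smul_eq_C_mul,
      RingHom.id_apply]

theorem polyOfCoeffs_apply (c : Fin n → R) :
    polyOfCoeffs n c = ∑ i : Fin n, C (c i) * X ^ (i : ℕ) := rfl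

theorem degree_polyOfCoeffs_lt (c : Fin n → R) : (polyOfCoeffs n c).degree < n :=
  degree_sum_fin_lt c

theorem toFn_polyOfCoeffs (c : Fin n → R) : toFn n (polyOfCoeffs n c) = c := by
  ext i
  simp [polyOfCoeffs_apply, toFn, coeff_X_pow, Fin.val_inj]

/-- The monic polynomial of degree `n` whose coefficient of `X ^ i` is `c i` for `i < n`. -/
noncomputable def toMonic (c : Fin n → R) : R[X] := X ^ n + polyOfCoeffs n c

theorem monic_toMonic (c : Fin n → R) : (toMonic c).Monic :=
  monic_X_pow_add (degree_polyOfCoeffs_lt c)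

theorem natDegree_toMonic [Nontrivial R] (c : Fin n → R) : (toMonic c).natDegree = n := by
  refine natDegree_eq_of_degree_eq_some ?_
  rw [toMonic, degree_add_eq_left_of_degree_lt] <;> rw [degree_X_pow]
  exact degree_polyOfCoeffs_lt c

theorem toFn_toMonic (c : Fin n → R) : toFn n (toMonic c) = c := by
  have htop : toFn n (X ^ n : R[X]) = 0 := by
    ext i
    simp [toFn, coeff_X_pow, i.2.ne]
  rw [toMonic, map_add, htop, toFn_polyOfCoeffs, zero_add]

theorem toMonic_toFn {p : R[X]} (hp : p.Monic) (hn : p.natDegree = n) :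
    toMonic (toFn n p) = p := by
  subst hn
  conv_rhs => rw [hp.as_sum, Finset.sum_range]
  rfl

theorem map_toMonic {S : Type*} [CommRing S] (φ : R →+* S) (c : Fin n → R) :
    (toMonic c).map φ = toMonic (φ ∘ c) := by
  simp [toMonic, polyOfCoeffs_apply, Polynomial.map_sum]

/-- The monic polynomial of degree `m` encoded by the first `m` coordinates. -/
noncomputable def leftFactor (v : Fin (m + n) → R) : R[X] :=
  toMonic fun i : Fin m => v (Fin.castAdd n i)

/-- The monic polynomial of degree `n` encoded by the last `n` coordinates. -/
noncomputable def rightFactor (v : Fin (m + n) → R) : R[X] :=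
  toMonic fun i : Fin n => v (Fin.natAdd m i)

theorem leftFactor_append (a : Fin m → R) (b : Fin n → R) :
    leftFactor (Fin.append a b) = toMonic a := by
  simp only [leftFactor, Fin.append_left]

theorem rightFactor_append (a : Fin m → R) (b : Fin n → R) :
    rightFactor (Fin.append a b) = toMonic b := by
  simp only [rightFactor, Fin.append_right]

/-- Multiplication of monic polynomials of degrees `m` and `n`, in coordinates. -/
noncomputable def mulMonic (m n : ℕ) (v : Fin (m + n) → R) : Fin (m + n) → R :=
  toFn (m + n) (leftFactor v * rightFactor v)

theorem toMonic_mulMonic [Nontrivial R] (v : Fin (m + n) → R) :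
    toMonic (mulMonic m n v) = leftFactor v * rightFactor v := by
  refine toMonic_toFn ((monic_toMonic _).mul (monic_toMonic _)) ?_
  rw [leftFactor, rightFactor, (monic_toMonic _).natDegree_mul (monic_toMonic _),
    natDegree_toMonic, natDegree_toMonic]

theorem mulMonic_eq_iff [Nontrivial R] {v b : Fin (m + n) → R} :
    mulMonic m n v = b ↔ leftFactor v * rightFactor v = toMonic b := by
  refine ⟨fun h => by rw [← h, toMonic_mulMonic], fun h => ?_⟩
  rw [mulMonic, h, toFn_toMonic]

theorem sylvester_mulVec {f g : R[X]} (hf : f.natDegree ≤ m) (hg : g.natDegree ≤ n)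
    (w : Fin (m + n) → R) :
    (sylvester f g m n).mulVec w = toFn (m + n)
      (g * polyOfCoeffs m (fun j => w (Fin.castAdd n j)) +
        f * polyOfCoeffs n (fun j => w (Fin.natAdd m j))) := by
  let B := ((degreeLT.basis R m).prod (degreeLT.basis R n)).reindex finSumFinEquiv
  have hB : B.equivFun.symm w =
      ((degreeLT.basis R m).equivFun.symm fun j => w (Fin.castAdd n j),
        (degreeLT.basis R n).equivFun.symm fun j => w (Fin.natAdd m j)) := by
    simp [B, Module.Basis.equivFun_symm_apply, Fin.sum_univ_add, Prod.ext_iff, Prod.fst_sum,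
      Prod.snd_sum]
  have hbasis : ∀ (k : ℕ) (c : Fin k → R),
      (((degreeLT.basis R k).equivFun.symm c : degreeLT R k) : R[X]) = polyOfCoeffs k c := by
    intro k c
    simp [Module.Basis.equivFun_symm_apply, polyOfCoeffs_apply, smul_eq_C_mul]
  have hrepr : ⇑(B.repr (B.equivFun.symm w)) = w := B.equivFun.apply_symm_apply w
  have h := LinearMap.toMatrix_mulVec_repr B (degreeLT.basis R (m + n)) (sylvesterMap f g hf hg)
    (B.equivFun.symm w)
  rw [toMatrix_sylvesterMap', hrepr, hB] at h
  rw [h]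
  ext i
  simp only [degreeLT.basis_repr, sylvesterMap_apply_coe, hbasis, toFn, LinearMap.pi_apply,
    lcoeff_apply]
  rw [add_comm]

end MonicCoordinates

section MulMonicDerivative

variable {m n : ℕ}

theorem hasFDerivAt_coeff_mul {E : Type*} [NormedAddCommGroup E] [NormedSpace ℝ E]
    [FiniteDimensional ℝ E] {f g : E → ℝ[X]} {A B : E →ₗ[ℝ] ℝ[X]} {v : E}
    (hf : ∀ k, HasFDerivAt (fun w => (f w).coeff k) (lcoeff ℝ k ∘ₗ A).toContinuousLinearMap v)
    (hg : ∀ k, HasFDerivAt (fun w => (g w).coeff k) (lcoeff ℝ k ∘ₗ B).toContinuousLinearMap v)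
    (k : ℕ) :
    HasFDerivAt (fun w => (f w * g w).coeff k)
      (lcoeff ℝ k ∘ₗ (LinearMap.mulLeft ℝ (g v) ∘ₗ A +
        LinearMap.mulLeft ℝ (f v) ∘ₗ B)).toContinuousLinearMap v := by
  simp only [coeff_mul]
  refine (HasFDerivAt.fun_sum fun ab _ => (hf ab.1).mul (hg ab.2)).congr_fderiv ?_
  ext w
  have hcomm : (g v * A w).coeff k =
      ∑ ab ∈ Finset.HasAntidiagonal.antidiagonal k, (g v).coeff ab.2 * (A w).coeff ab.1 := by
    simp only [mul_comm (g v), coeff_mul, mul_comm ((A w).coeff _)]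
  simp [hcomm, coeff_mul, Finset.sum_add_distrib, add_comm]

theorem hasFDerivAt_coeff_toMonic_comp {E : Type*} [NormedAddCommGroup E] [NormedSpace ℝ E]
    [FiniteDimensional ℝ E] (L : E →ₗ[ℝ] (Fin n → ℝ)) (v : E) (k : ℕ) :
    HasFDerivAt (fun w => (toMonic (L w)).coeff k)
      (lcoeff ℝ k ∘ₗ polyOfCoeffs n ∘ₗ L).toContinuousLinearMap v := by
  simp only [toMonic, coeff_add]
  exact (lcoeff ℝ k ∘ₗ polyOfCoeffs n ∘ₗ L).toContinuousLinearMap.hasFDerivAt.const_add _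

/-- The derivative of `mulMonic m n`: its matrix is the Sylvester matrix of the two factors. -/
noncomputable def mulMonicDeriv (m n : ℕ) (v : Fin (m + n) → ℝ) :
    (Fin (m + n) → ℝ) →L[ℝ] (Fin (m + n) → ℝ) :=
  (sylvester (leftFactor v) (rightFactor v) m n).toLin'.toContinuousLinearMap

theorem det_mulMonicDeriv (v : Fin (m + n) → ℝ) :
    (mulMonicDeriv m n v).det = resultant (leftFactor (n := n) v) (rightFactor (m := m) v) := by
  rw [mulMonicDeriv, ContinuousLinearMap.det, LinearMap.coe_toContinuousLinearMap,
    LinearMap.det_toLin', resultant, leftFactor, rightFactor, natDegree_toMonic,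
    natDegree_toMonic]

theorem hasFDerivAt_mulMonic (v : Fin (m + n) → ℝ) :
    HasFDerivAt (mulMonic m n) (mulMonicDeriv m n v) v := by
  refine hasFDerivAt_pi'' fun i => ?_
  refine (hasFDerivAt_coeff_mul
    (hasFDerivAt_coeff_toMonic_comp (LinearMap.funLeft ℝ ℝ (Fin.castAdd n)) v)
    (hasFDerivAt_coeff_toMonic_comp (LinearMap.funLeft ℝ ℝ (Fin.natAdd m)) v) i).congr_fderiv ?_
  ext1 w
  exact (congrFun (sylvester_mulVec (f := leftFactor v) (g := rightFactor v)
    (natDegree_toMonic _).le (natDegree_toMonic _).le w) i).symm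

end MulMonicDerivative

section Squarefree

theorem ae_isCoprime_of_toMonic_eq_mul (m n : ℕ) :
    ∀ᵐ b : Fin (m + n) → ℝ, ∀ r g : ℝ[X], r.Monic → g.Monic → r.natDegree = m →
      g.natDegree = n → toMonic b = r * g → IsCoprime r g := by
  refine measure_mono_null ?_ (addHaar_image_eq_zero_of_det_fderivWithin_eq_zero volume
    (fun v _ => (hasFDerivAt_mulMonic v).hasFDerivWithinAt)
    (s := {v | (mulMonicDeriv m n v).det = 0}) fun _ hv => hv)
  intro b hb
  simp only [Set.mem_compl_iff, Set.mem_ofPred_eq, not_forall] at hb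
  obtain ⟨r, g, hr, hg, hrm, hgn, hbrg, hcop⟩ := hb
  refine ⟨Fin.append (toFn m r) (toFn n g), ?_, ?_⟩
  · rw [Set.mem_ofPred_eq, det_mulMonicDeriv, leftFactor_append, rightFactor_append,
      toMonic_toFn hr hrm, toMonic_toFn hg hgn, resultant_eq_zero_iff]
    exact ⟨Or.inl hr.ne_zero, hcop⟩
  · rw [mulMonic_eq_iff, leftFactor_append, rightFactor_append, toMonic_toFn hr hrm,
      toMonic_toFn hg hgn, hbrg]

theorem squarefree_of_forall_monic_isCoprime {K : Type*} [Field K] {p : K[X]} (hp : p.Monic)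
    (h : ∀ r g : K[X], r.Monic → g.Monic → p = r * g → IsCoprime r g) : Squarefree p := by
  rintro r ⟨g, hg⟩
  have hr : r ≠ 0 := by
    rintro rfl
    exact hp.ne_zero (by rw [hg, zero_mul, zero_mul])
  have hunit : C r.leadingCoeff⁻¹ * C r.leadingCoeff = 1 := by
    rw [← C_mul, inv_mul_cancel₀ (leadingCoeff_ne_zero.2 hr), C_1]
  have hmonic : (r * C r.leadingCoeff⁻¹).Monic := monic_mul_leadingCoeff_inv hr
  have hprod : p = r * C r.leadingCoeff⁻¹ * (C r.leadingCoeff * r * g) := by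
    rw [hg]
    linear_combination (-(r * r * g)) * hunit
  have hcop := h _ _ hmonic (hmonic.of_mul_monic_left (hprod ▸ hp)) hprod
  exact hcop.isUnit_of_dvd' (Dvd.intro _ rfl) ⟨C r.leadingCoeff * g, by ring⟩

theorem ae_squarefree_toMonic (N : ℕ) : ∀ᵐ b : Fin N → ℝ, Squarefree (toMonic b) := by
  have hcop : ∀ m n : ℕ, m + n = N → ∀ᵐ b : Fin N → ℝ, ∀ r g : ℝ[X], r.Monic → g.Monic →
      r.natDegree = m → g.natDegree = n → toMonic b = r * g → IsCoprime r g := by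
    rintro m n rfl
    exact ae_isCoprime_of_toMonic_eq_mul m n
  simp only [← Filter.eventually_imp_distrib_left, ← ae_all_iff] at hcop
  filter_upwards [hcop] with b hb
  refine squarefree_of_forall_monic_isCoprime (monic_toMonic b) fun r g hr hg hprod => ?_
  refine hb r.natDegree g.natDegree ?_ r g hr hg rfl rfl hprod
  rw [← hr.natDegree_mul hg, ← hprod, natDegree_toMonic]

end Squarefree

section QuadraticRoots

/-- The discriminant of the quadratic `toMonic q = X ^ 2 + q 1 * X + q 0`. -/
def quadDisc (q : Fin 2 → ℝ) : ℝ := q 1 ^ 2 - 4 * q 0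

/-- The first root of `toMonic q`: the smaller one if the roots are real, the one in the lower half
plane otherwise. Both cases are covered by one formula since `√x = 0` for `x ≤ 0`. -/
noncomputable def rootFst (q : Fin 2 → ℝ) : ℂ :=
  ⟨(-q 1 - √(quadDisc q)) / 2, -√(-quadDisc q) / 2⟩

/-- The second root of `toMonic q`: the larger one if the roots are real, the one in the upper half
plane otherwise. -/
noncomputable def rootSnd (q : Fin 2 → ℝ) : ℂ :=
  ⟨(-q 1 + √(quadDisc q)) / 2, √(-quadDisc q) / 2⟩

/-- The coordinates of the real quadratic with real roots `p.1` and `p.2`. -/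
def quadOfReal (p : ℝ × ℝ) : Fin 2 → ℝ := ![p.1 * p.2, -(p.1 + p.2)]

/-- The coordinates of the real quadratic with roots `β` and its conjugate. -/
def quadOfComplex (β : ℂ) : Fin 2 → ℝ := ![β.re ^ 2 + β.im ^ 2, -(2 * β.re)]

theorem rootFst_add_rootSnd (q : Fin 2 → ℝ) : rootFst q + rootSnd q = -(q 1 : ℂ) := by
  apply Complex.ext <;> simp [rootFst, rootSnd] <;> ring

theorem rootFst_mul_rootSnd (q : Fin 2 → ℝ) : rootFst q * rootSnd q = (q 0 : ℂ) := by
  have hsqrt : √(quadDisc q) ^ 2 - √(-quadDisc q) ^ 2 = quadDisc q ∧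
      √(quadDisc q) * √(-quadDisc q) = 0 := by
    rcases le_total 0 (quadDisc q) with h | h
    · simp [Real.sqrt_eq_zero_of_nonpos (neg_nonpos.2 h), Real.sq_sqrt h]
    · simp [Real.sqrt_eq_zero_of_nonpos h, Real.sq_sqrt (neg_nonneg.2 h)]
  have hdisc : quadDisc q = q 1 ^ 2 - 4 * q 0 := rfl
  apply Complex.ext
  · simp only [rootFst, rootSnd, Complex.mul_re, Complex.ofReal_re]
    linear_combination (-1 / 4 : ℝ) * (hsqrt.1.trans hdisc)
  · simp only [rootFst, rootSnd, Complex.mul_im, Complex.ofReal_im]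
    linear_combination (-1 / 2 : ℝ) * hsqrt.2

theorem ofReal_quadDisc (q : Fin 2 → ℝ) : (quadDisc q : ℂ) = (rootSnd q - rootFst q) ^ 2 := by
  simp only [quadDisc, Complex.ofReal_sub, Complex.ofReal_mul, Complex.ofReal_pow,
    Complex.ofReal_ofNat]
  linear_combination (q 1 - rootFst q - rootSnd q) * rootFst_add_rootSnd q +
    4 * rootFst_mul_rootSnd q

theorem rootFst_ne_rootSnd {q : Fin 2 → ℝ} (h : quadDisc q ≠ 0) : rootFst q ≠ rootSnd q := by
  intro heq
  have hsq := ofReal_quadDisc q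
  rw [heq, sub_self, zero_pow two_ne_zero] at hsq
  exact h (Complex.ofReal_eq_zero.1 hsq)

theorem map_toMonic_two (q : Fin 2 → ℝ) :
    (toMonic q).map (algebraMap ℝ ℂ) = (X - C (rootFst q)) * (X - C (rootSnd q)) := by
  have hadd := congrArg (C : ℂ → ℂ[X]) (rootFst_add_rootSnd q)
  have hmul := congrArg (C : ℂ → ℂ[X]) (rootFst_mul_rootSnd q)
  simp only [C_add, C_mul, C_neg] at hadd hmul
  rw [map_toMonic, toMonic, polyOfCoeffs_apply, Fin.sum_univ_two]
  simp only [Function.comp_apply, Complex.coe_algebraMap, Fin.val_zero, Fin.val_one]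
  linear_combination (X : ℂ[X]) * hadd - hmul

theorem aeval_toMonic_two (q : Fin 2 → ℝ) (z : ℂ) :
    aeval z (toMonic q) = (z - rootFst q) * (z - rootSnd q) := by
  rw [← eval_map_algebraMap, map_toMonic_two, eval_mul, eval_sub, eval_sub, eval_X, eval_C, eval_C]

theorem resultant_toMonic_two (q : Fin 2 → ℝ) (g : ℝ[X]) :
    ((resultant (toMonic q) g : ℝ) : ℂ) = aeval (rootFst q) g * aeval (rootSnd q) g := by
  have hg : (g.map (algebraMap ℝ ℂ)).natDegree ≤ g.natDegree := natDegree_map_le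
  have hmul := resultant_mul_left (X - C (rootFst q)) (X - C (rootSnd q)) (g.map (algebraMap ℝ ℂ))
    g.natDegree hg
  rw [natDegree_X_sub_C, natDegree_X_sub_C, resultant_X_sub_C_left _ _ _ hg,
    resultant_X_sub_C_left _ _ _ hg, ← map_toMonic_two, eval_map_algebraMap,
    eval_map_algebraMap] at hmul
  rw [← hmul, natDegree_toMonic]
  exact (resultant_map_map (toMonic q) g 2 g.natDegree (algebraMap ℝ ℂ)).symm

theorem quadDisc_quadOfReal (p : ℝ × ℝ) : quadDisc (quadOfReal p) = (p.2 - p.1) ^ 2 := by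
  simp only [quadDisc, quadOfReal, Matrix.cons_val_zero, Matrix.cons_val_one]
  ring

theorem quadDisc_quadOfComplex (β : ℂ) : quadDisc (quadOfComplex β) = -(2 * β.im) ^ 2 := by
  simp only [quadDisc, quadOfComplex, Matrix.cons_val_zero, Matrix.cons_val_one]
  ring

theorem rootFst_quadOfReal {p : ℝ × ℝ} (h : p.1 ≤ p.2) : rootFst (quadOfReal p) = p.1 := by
  have hpos : √((p.2 - p.1) ^ 2) = p.2 - p.1 := Real.sqrt_sq (sub_nonneg.2 h)
  have hneg : √(-(p.2 - p.1) ^ 2) = 0 := Real.sqrt_eq_zero_of_nonpos (neg_nonpos.2 (sq_nonneg _))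
  have hone : quadOfReal p 1 = -(p.1 + p.2) := rfl
  apply Complex.ext <;> simp [rootFst, quadDisc_quadOfReal, hpos, hneg, hone]
  ring

theorem rootSnd_quadOfReal {p : ℝ × ℝ} (h : p.1 ≤ p.2) : rootSnd (quadOfReal p) = p.2 := by
  have hone : quadOfReal p 1 = -(p.1 + p.2) := rfl
  have hsum := rootFst_add_rootSnd (quadOfReal p)
  simp only [rootFst_quadOfReal h, hone, Complex.ofReal_neg, Complex.ofReal_add] at hsum
  linear_combination hsum

theorem rootSnd_quadOfComplex {β : ℂ} (h : 0 ≤ β.im) : rootSnd (quadOfComplex β) = β := by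
  have hpos : √((2 * β.im) ^ 2) = 2 * β.im := Real.sqrt_sq (by positivity)
  have hneg : √(-(2 * β.im) ^ 2) = 0 := Real.sqrt_eq_zero_of_nonpos (neg_nonpos.2 (sq_nonneg _))
  have hone : quadOfComplex β 1 = -(2 * β.re) := rfl
  apply Complex.ext <;> simp [rootSnd, quadDisc_quadOfComplex, hpos, hneg, hone]

theorem rootFst_quadOfComplex {β : ℂ} (h : 0 ≤ β.im) :
    rootFst (quadOfComplex β) = starRingEnd ℂ β := by
  have hone : quadOfComplex β 1 = -(2 * β.re) := rfl
  have hsum := rootFst_add_rootSnd (quadOfComplex β)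
  rw [rootSnd_quadOfComplex h, hone, Complex.ofReal_neg, neg_neg, ← Complex.add_conj] at hsum
  linear_combination hsum

theorem exists_quadOfReal_eq {q : Fin 2 → ℝ} (h : 0 < quadDisc q) :
    ∃ p : ℝ × ℝ, p.1 < p.2 ∧ quadOfReal p = q := by
  have hs := Real.sq_sqrt h.le
  have hdisc : quadDisc q = q 1 ^ 2 - 4 * q 0 := rfl
  refine ⟨((-q 1 - √(quadDisc q)) / 2, (-q 1 + √(quadDisc q)) / 2),
    by linarith [Real.sqrt_pos.2 h], ?_⟩
  ext i
  fin_cases i <;> simp only [quadOfReal, Fin.zero_eta, Fin.mk_one, Matrix.cons_val_zero,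
    Matrix.cons_val_one]
  · linear_combination (-1 / 4 : ℝ) * (hs.trans hdisc)
  · ring

theorem exists_quadOfComplex_eq {q : Fin 2 → ℝ} (h : quadDisc q < 0) :
    ∃ β : ℂ, 0 < β.im ∧ quadOfComplex β = q := by
  have hs := Real.sq_sqrt (neg_pos.2 h).le
  have hdisc : quadDisc q = q 1 ^ 2 - 4 * q 0 := rfl
  refine ⟨⟨-q 1 / 2, √(-quadDisc q) / 2⟩, half_pos (Real.sqrt_pos.2 (neg_pos.2 h)), ?_⟩
  ext i
  fin_cases i <;> simp only [quadOfComplex, Fin.zero_eta, Fin.mk_one, Matrix.cons_val_zero,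
    Matrix.cons_val_one]
  · linear_combination (1 / 4 : ℝ) * hs - (1 / 4 : ℝ) * hdisc
  · ring

theorem injOn_quadOfReal : Set.InjOn quadOfReal {p | 0 < p.2 - p.1} := by
  intro p hp p' hp' h
  have hfst := congrArg rootFst h
  have hsnd := congrArg rootSnd h
  rw [rootFst_quadOfReal (sub_pos.1 hp).le, rootFst_quadOfReal (sub_pos.1 hp').le] at hfst
  rw [rootSnd_quadOfReal (sub_pos.1 hp).le, rootSnd_quadOfReal (sub_pos.1 hp').le] at hsnd
  exact Prod.ext (Complex.ofReal_injective hfst) (Complex.ofReal_injective hsnd)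

theorem injOn_quadOfComplex : Set.InjOn quadOfComplex {β | 0 < β.im} := by
  intro β hβ β' hβ' h
  have hsnd := congrArg rootSnd h
  rwa [rootSnd_quadOfComplex (le_of_lt hβ), rootSnd_quadOfComplex (le_of_lt hβ')] at hsnd

end QuadraticRoots

section RootSigns

theorem real_sign_mul (x y : ℝ) : Real.sign (x * y) = Real.sign x * Real.sign y := by
  rcases lt_trichotomy x 0 with hx | rfl | hx <;> rcases lt_trichotomy y 0 with hy | rfl | hy <;>
    simp [Real.sign_of_neg, Real.sign_of_pos, *, mul_pos_of_neg_of_neg, mul_neg_of_neg_of_pos,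
      mul_neg_of_pos_of_neg]

theorem sum_sign_derivative_nodal (R : Finset ℝ) :
    ∑ a ∈ R, Real.sign ((derivative (Lagrange.nodal R id)).eval a) =
      if Even R.card then 0 else 1 := by
  induction R using Finset.induction_on_max with
  | empty => simp
  | insert m R hm ih =>
    have hmR : m ∉ R := fun h => lt_irrefl _ (hm m h)
    have hderiv : ∀ a, (derivative (Lagrange.nodal (insert m R) id)).eval a =
        (Lagrange.nodal R id).eval a + (a - m) * (derivative (Lagrange.nodal R id)).eval a := by
      intro a
      simp [Lagrange.nodal_insert_eq_nodal hmR]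
    have hmax : Real.sign ((derivative (Lagrange.nodal (insert m R) id)).eval m) = 1 := by
      rw [hderiv, sub_self, zero_mul, add_zero, Lagrange.eval_nodal]
      exact Real.sign_of_pos (Finset.prod_pos fun c hc => sub_pos.2 (hm c hc))
    have hflip : ∀ a ∈ R, Real.sign ((derivative (Lagrange.nodal (insert m R) id)).eval a) =
        -Real.sign ((derivative (Lagrange.nodal R id)).eval a) := by
      intro a ha
      have hzero : (Lagrange.nodal R id).eval a = 0 := Lagrange.eval_nodal_at_node (v := id) ha
      rw [hderiv, hzero, zero_add, real_sign_mul, Real.sign_of_neg (sub_neg.2 (hm a ha)),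
        neg_one_mul]
    rw [Finset.sum_insert hmR, hmax, Finset.sum_congr rfl hflip, Finset.sum_neg_distrib, ih,
      Finset.card_insert_of_notMem hmR]
    by_cases h : Even R.card <;> simp [h, Nat.even_add_one]

theorem sign_eval_eq_of_roots_eq_zero {k : ℝ[X]} (h0 : k ≠ 0) (hr : k.roots = 0) (a b : ℝ) :
    Real.sign (k.eval a) = Real.sign (k.eval b) := by
  have hne : ∀ x, k.eval x ≠ 0 := fun x hx => by
    simpa [hr] using (mem_roots h0).2 hx
  have hpos_of_pos : ∀ x y, 0 < k.eval x → 0 < k.eval y := by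
    intro x y hx
    by_contra! hy
    obtain ⟨z, hz⟩ := mem_range_of_exists_le_of_exists_ge k.continuous ⟨y, hy⟩ ⟨x, hx.le⟩
    exact hne z hz
  rcases (hne a).lt_or_gt with ha | ha
  · rw [Real.sign_of_neg ha, Real.sign_of_neg]
    exact (not_lt.1 fun hb => ha.not_gt (hpos_of_pos b a hb)).lt_of_ne (hne b)
  · rw [Real.sign_of_pos ha, Real.sign_of_pos (hpos_of_pos a b ha)]

theorem sum_sign_derivative_roots {p : ℝ[X]} (hp : p.Separable)
    (heven : Even p.roots.toFinset.card) :
    ∑ a ∈ p.roots.toFinset, Real.sign ((derivative p).eval a) = 0 := by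
  obtain ⟨k, hprod, -, hk⟩ := exists_prod_multiset_X_sub_C_mul p
  have hk0 : k ≠ 0 := by
    rintro rfl
    exact hp.ne_zero (by rw [← hprod, mul_zero])
  have hnodal : (p.roots.map fun a => X - C a).prod = Lagrange.nodal p.roots.toFinset id := by
    rw [Lagrange.nodal_eq, Finset.prod, Multiset.toFinset_val, (nodup_roots hp).dedup]
    rfl
  rw [hnodal] at hprod
  have hsign : ∀ a ∈ p.roots.toFinset, Real.sign ((derivative p).eval a) =
      Real.sign ((derivative (Lagrange.nodal p.roots.toFinset id)).eval a) *
        Real.sign (k.eval 0) := by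
    intro a ha
    have hzero : (Lagrange.nodal p.roots.toFinset id).eval a = 0 :=
      Lagrange.eval_nodal_at_node (v := id) ha
    conv_lhs => rw [← hprod]
    rw [derivative_mul, eval_add, eval_mul, eval_mul, hzero, zero_mul, add_zero, real_sign_mul,
      sign_eval_eq_of_roots_eq_zero hk0 hk a 0]
  rw [Finset.sum_congr rfl hsign, ← Finset.sum_mul, sum_sign_derivative_nodal, if_pos heven,
    zero_mul]

theorem two_mul_sum_filter_lt (R : Finset ℝ) (e : ℝ → ℝ) :
    2 * ∑ p ∈ R ×ˢ R with p.1 < p.2, e p.1 * e p.2 = (∑ a ∈ R, e a) ^ 2 - ∑ a ∈ R, e a ^ 2 := by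
  have hswap : ∑ p ∈ R ×ˢ R with p.2 < p.1, e p.1 * e p.2 =
      ∑ p ∈ R ×ˢ R with p.1 < p.2, e p.1 * e p.2 :=
    Finset.sum_nbij' Prod.swap Prod.swap (by simp +contextual) (by simp +contextual) (by simp)
      (by simp) fun _ _ => mul_comm _ _
  have hdiag : ∑ p ∈ R ×ˢ R with p.1 = p.2, e p.1 * e p.2 = ∑ a ∈ R, e a ^ 2 := by
    rw [Finset.sum_filter, Finset.sum_product]
    refine Finset.sum_congr rfl fun a ha => ?_
    rw [Finset.sum_ite_eq, if_pos ha, sq]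
  have hsplit : ∑ p ∈ R ×ˢ R, e p.1 * e p.2 = ∑ p ∈ R ×ˢ R with p.1 < p.2, e p.1 * e p.2 +
      ∑ p ∈ R ×ˢ R with p.2 < p.1, e p.1 * e p.2 + ∑ p ∈ R ×ˢ R with p.1 = p.2, e p.1 * e p.2 := by
    simp only [Finset.sum_filter, ← Finset.sum_add_distrib]
    refine Finset.sum_congr rfl fun p _ => ?_
    rcases lt_trichotomy p.1 p.2 with h | h | h
    · simp [h, h.not_gt, h.ne]
    · simp [h]
    · simp [h, h.not_gt, h.ne']
  rw [Finset.sum_product' (f := fun a b => e a * e b), ← Finset.sum_mul_sum, hswap, hdiag] at hsplit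
  linear_combination -hsplit

end RootSigns

section QuadraticDivisors

/-- The ordered pairs of distinct real roots of `p`. -/
noncomputable def realRootPairs (p : ℝ[X]) : Finset (ℝ × ℝ) :=
  (p.roots.toFinset ×ˢ p.roots.toFinset).filter fun a => a.1 < a.2

/-- The roots of `p` in the upper half plane. -/
noncomputable def upperRoots (p : ℝ[X]) : Finset ℂ :=
  (p.aroots ℂ).toFinset.filter fun z => 0 < z.im

/-- The coordinates of the monic quadratic divisors of `p`, provided that `p` is separable: such a
divisor has two distinct real roots or two conjugate nonreal ones. -/
noncomputable def quadDivisors (p : ℝ[X]) : Finset (Fin 2 → ℝ) :=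
  (realRootPairs p).image quadOfReal ∪ (upperRoots p).image quadOfComplex

variable {p : ℝ[X]}

theorem mem_realRootPairs (hp : p ≠ 0) {a : ℝ × ℝ} :
    a ∈ realRootPairs p ↔ (p.eval a.1 = 0 ∧ p.eval a.2 = 0) ∧ a.1 < a.2 := by
  simp [realRootPairs, hp]

theorem mem_upperRoots (hp : p ≠ 0) {z : ℂ} : z ∈ upperRoots p ↔ aeval z p = 0 ∧ 0 < z.im := by
  simp [upperRoots, hp]

theorem toFinset_aroots_complex (hp : p ≠ 0) :
    (p.aroots ℂ).toFinset = p.roots.toFinset.image ((↑) : ℝ → ℂ) ∪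
      (upperRoots p ∪ (upperRoots p).image (starRingEnd ℂ)) := by
  ext z
  simp only [Multiset.mem_toFinset, mem_aroots, mem_roots hp, Finset.mem_union, Finset.mem_image,
    mem_upperRoots hp, IsRoot, ne_eq, hp, not_false_eq_true, true_and]
  constructor
  · intro hz
    rcases lt_trichotomy z.im 0 with h | h | h
    · exact Or.inr (Or.inr ⟨starRingEnd ℂ z, ⟨by rw [aeval_conj, hz, map_zero], by simpa⟩,
        Complex.conj_conj z⟩)
    · have hre : (z.re : ℂ) = z := Complex.ext rfl h.symm
      rw [← hre, Complex.coe_algebraMap.symm, aeval_algebraMap_apply] at hz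
      exact Or.inl ⟨z.re, by simpa using hz, hre⟩
    · exact Or.inr (Or.inl ⟨hz, h⟩)
  · rintro (⟨x, hx, rfl⟩ | ⟨hz, -⟩ | ⟨w, ⟨hw, -⟩, rfl⟩)
    · exact (aeval_ofReal p x).trans (by simp [hx])
    · exact hz
    · rw [aeval_conj, hw, map_zero]

theorem card_roots_add_two_mul_card_upperRoots (hp : p.Separable) :
    p.roots.toFinset.card + 2 * (upperRoots p).card = p.natDegree := by
  have hdeg : (p.aroots ℂ).toFinset.card = p.natDegree := by
    rw [Multiset.toFinset_card_of_nodup (nodup_roots hp.map),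
      ← (IsAlgClosed.splits _).natDegree_eq_card_roots, natDegree_map]
  have him : ∀ z ∈ upperRoots p, 0 < z.im := fun z hz => ((mem_upperRoots hp.ne_zero).1 hz).2
  have hconj : Disjoint (upperRoots p) ((upperRoots p).image (starRingEnd ℂ)) := by
    simp only [Finset.disjoint_left, Finset.mem_image, not_exists, not_and]
    rintro _ hz w hw rfl
    exact (him _ hz).not_gt (by simpa using him w hw)
  have hreal : Disjoint (p.roots.toFinset.image ((↑) : ℝ → ℂ))
      (upperRoots p ∪ (upperRoots p).image (starRingEnd ℂ)) := by
    simp only [Finset.disjoint_left, Finset.mem_image, Finset.mem_union]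
    rintro _ ⟨x, -, rfl⟩ (hz | ⟨w, hw, hwx⟩)
    · exact (him _ hz).ne' (Complex.ofReal_im x)
    · exact (him w hw).ne' (by simpa using congrArg Complex.im hwx)
  rw [← hdeg, toFinset_aroots_complex hp.ne_zero, Finset.card_union_of_disjoint hreal,
    Finset.card_union_of_disjoint hconj, Finset.card_image_of_injective _ Complex.ofReal_injective,
    Finset.card_image_of_injective _ (starRingEnd ℂ).injective, two_mul]

theorem toMonic_dvd_iff {q : Fin 2 → ℝ} (hq : quadDisc q ≠ 0) :
    toMonic q ∣ p ↔ aeval (rootFst q) p = 0 ∧ aeval (rootSnd q) p = 0 := by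
  rw [← map_dvd_map (algebraMap ℝ ℂ) (algebraMap ℝ ℂ).injective (monic_toMonic q),
    map_toMonic_two, ← eval_map_algebraMap, ← eval_map_algebraMap, ← IsRoot, ← IsRoot,
    ← dvd_iff_isRoot, ← dvd_iff_isRoot]
  exact ⟨fun h => ⟨dvd_of_mul_right_dvd h, dvd_of_mul_left_dvd h⟩, fun h =>
    (isCoprime_X_sub_C_of_isUnit_sub (sub_ne_zero.2 (rootFst_ne_rootSnd hq)).isUnit).mul_dvd
      h.1 h.2⟩

theorem toMonic_quadOfReal_dvd_iff {a : ℝ × ℝ} (ha : a.1 < a.2) :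
    toMonic (quadOfReal a) ∣ p ↔ p.eval a.1 = 0 ∧ p.eval a.2 = 0 := by
  have hdisc : quadDisc (quadOfReal a) ≠ 0 := by
    rw [quadDisc_quadOfReal]
    exact pow_ne_zero 2 (sub_ne_zero.2 ha.ne')
  have haeval : ∀ x : ℝ, aeval (x : ℂ) p = p.eval x := aeval_ofReal p
  rw [toMonic_dvd_iff hdisc, rootFst_quadOfReal ha.le, rootSnd_quadOfReal ha.le, haeval, haeval,
    Complex.ofReal_eq_zero, Complex.ofReal_eq_zero]

theorem toMonic_quadOfComplex_dvd_iff {β : ℂ} (hβ : 0 < β.im) :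
    toMonic (quadOfComplex β) ∣ p ↔ aeval β p = 0 := by
  have hdisc : quadDisc (quadOfComplex β) ≠ 0 := by
    rw [quadDisc_quadOfComplex]
    exact neg_ne_zero.2 (pow_ne_zero 2 (by positivity))
  rw [toMonic_dvd_iff hdisc, rootFst_quadOfComplex hβ.le, rootSnd_quadOfComplex hβ.le, aeval_conj,
    map_eq_zero, and_self]

theorem quadDisc_ne_zero_of_dvd (hp : p.Separable) {q : Fin 2 → ℝ} (hq : toMonic q ∣ p) :
    quadDisc q ≠ 0 := by
  intro hdisc
  have heq : rootSnd q = rootFst q := by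
    simpa [hdisc, sub_eq_zero] using (ofReal_quadDisc q).symm
  have hsep : ((toMonic q).map (algebraMap ℝ ℂ)).Separable := (hp.of_dvd hq).map
  rw [map_toMonic_two, heq] at hsep
  exact not_isUnit_X_sub_C _ (hsep.squarefree _ dvd_rfl)

theorem mem_quadDivisors (hp : p.Separable) {q : Fin 2 → ℝ} :
    q ∈ quadDivisors p ↔ toMonic q ∣ p := by
  simp only [quadDivisors, Finset.mem_union, Finset.mem_image, mem_realRootPairs hp.ne_zero,
    mem_upperRoots hp.ne_zero]
  constructor
  · rintro (⟨a, ⟨hroots, ha⟩, rfl⟩ | ⟨β, ⟨hroot, hβ⟩, rfl⟩)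
    · exact (toMonic_quadOfReal_dvd_iff ha).2 hroots
    · exact (toMonic_quadOfComplex_dvd_iff hβ).2 hroot
  · intro hdvd
    rcases (quadDisc_ne_zero_of_dvd hp hdvd).lt_or_gt with h | h
    · obtain ⟨β, hβ, rfl⟩ := exists_quadOfComplex_eq h
      exact Or.inr ⟨β, ⟨(toMonic_quadOfComplex_dvd_iff hβ).1 hdvd, hβ⟩, rfl⟩
    · obtain ⟨a, ha, rfl⟩ := exists_quadOfReal_eq h
      exact Or.inl ⟨a, ⟨(toMonic_quadOfReal_dvd_iff ha).1 hdvd, ha⟩, rfl⟩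

theorem sum_quadDivisors (hp : p ≠ 0) (f : (Fin 2 → ℝ) → ℝ) :
    ∑ q ∈ quadDivisors p, f q =
      ∑ a ∈ realRootPairs p, f (quadOfReal a) + ∑ β ∈ upperRoots p, f (quadOfComplex β) := by
  have him : ∀ β ∈ upperRoots p, 0 < β.im := fun β hβ => ((mem_upperRoots hp).1 hβ).2
  have hinjReal : Set.InjOn quadOfReal (realRootPairs p) :=
    injOn_quadOfReal.mono fun a ha => sub_pos.2 ((mem_realRootPairs hp).1 ha).2
  have hinjComplex : Set.InjOn quadOfComplex (upperRoots p) := injOn_quadOfComplex.mono him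
  have hdisj : Disjoint ((realRootPairs p).image quadOfReal)
      ((upperRoots p).image quadOfComplex) := by
    simp only [Finset.disjoint_left, Finset.mem_image, not_exists, not_and]
    rintro _ ⟨a, -, rfl⟩ β hβ heq
    have hdisc := congrArg quadDisc heq
    rw [quadDisc_quadOfReal, quadDisc_quadOfComplex] at hdisc
    nlinarith [him β hβ, sq_nonneg (a.2 - a.1)]
  rw [quadDivisors, Finset.sum_union hdisj, Finset.sum_image hinjReal,
    Finset.sum_image hinjComplex]

theorem card_quadDivisors_le (hp : p.Separable) : (quadDivisors p).card ≤ p.natDegree ^ 2 := by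
  have hpairs : (realRootPairs p).card ≤ p.roots.toFinset.card * p.roots.toFinset.card :=
    (Finset.card_filter_le _ _).trans (Finset.card_product _ _).le
  calc (quadDivisors p).card ≤ (realRootPairs p).card + (upperRoots p).card :=
        (Finset.card_union_le _ _).trans (add_le_add Finset.card_image_le Finset.card_image_le)
    _ ≤ p.natDegree ^ 2 := by
        rw [← card_roots_add_two_mul_card_upperRoots hp]
        nlinarith [Nat.le_mul_self (upperRoots p).card]

end QuadraticDivisors

section FiberCount

theorem resultant_mul_quadDisc (q : Fin 2 → ℝ) (g : ℝ[X]) :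
    ((resultant (toMonic q) g * quadDisc q : ℝ) : ℂ) =
      -(aeval (rootFst q) (derivative (toMonic q * g)) *
        aeval (rootSnd q) (derivative (toMonic q * g))) := by
  have hderiv : ∀ z : ℂ, aeval z (derivative (toMonic q)) = (z - rootFst q) + (z - rootSnd q) := by
    intro z
    rw [← eval_map_algebraMap, ← derivative_map, map_toMonic_two]
    simp [add_comm]
  rw [Complex.ofReal_mul, resultant_toMonic_two, ofReal_quadDisc]
  simp only [derivative_mul, map_add, map_mul, hderiv, aeval_toMonic_two]
  ring

variable {p g : ℝ[X]}

theorem sign_resultant_quadOfReal {a : ℝ × ℝ} (ha : a.1 < a.2)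
    (h : p = toMonic (quadOfReal a) * g) :
    Real.sign (resultant (toMonic (quadOfReal a)) g) =
      -(Real.sign ((derivative p).eval a.1) * Real.sign ((derivative p).eval a.2)) := by
  have haeval : ∀ x : ℝ, aeval (x : ℂ) (derivative p) = (derivative p).eval x := aeval_ofReal _
  have hres := resultant_mul_quadDisc (quadOfReal a) g
  rw [← h, rootFst_quadOfReal ha.le, rootSnd_quadOfReal ha.le, haeval, haeval] at hres
  have hres' : resultant (toMonic (quadOfReal a)) g * quadDisc (quadOfReal a) =
      -((derivative p).eval a.1 * (derivative p).eval a.2) := by exact_mod_cast hres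
  have hdisc : 0 < quadDisc (quadOfReal a) := by
    rw [quadDisc_quadOfReal]
    exact pow_pos (sub_pos.2 ha) 2
  rw [← real_sign_mul, ← Real.sign_neg, ← hres', real_sign_mul, Real.sign_of_pos hdisc, mul_one]

theorem sign_resultant_quadOfComplex (hp : p.Separable) {β : ℂ} (hβ : 0 < β.im)
    (h : p = toMonic (quadOfComplex β) * g) :
    Real.sign (resultant (toMonic (quadOfComplex β)) g) = 1 := by
  have hres := resultant_toMonic_two (quadOfComplex β) g
  rw [rootFst_quadOfComplex hβ.le, rootSnd_quadOfComplex hβ.le, aeval_conj,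
    ← Complex.normSq_eq_conj_mul_self, Complex.ofReal_inj] at hres
  have hne : resultant (toMonic (quadOfComplex β)) g ≠ 0 := fun h0 =>
    (resultant_eq_zero_iff.1 h0).2 (h ▸ hp).isCoprime
  exact Real.sign_of_pos ((hres ▸ Complex.normSq_nonneg _).lt_of_ne hne.symm)

theorem sum_sign_resultant_quadDivisors (hp : p.Separable) (heven : Even p.natDegree) :
    ∑ q ∈ quadDivisors p, Real.sign (resultant (toMonic q) (p / toMonic q)) =
      (p.natDegree : ℝ) / 2 := by
  set e : ℝ → ℝ := fun x => Real.sign ((derivative p).eval x) with he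
  have hprod : ∀ q ∈ quadDivisors p, p = toMonic q * (p / toMonic q) := fun q hq =>
    (EuclideanDomain.mul_div_cancel' (monic_toMonic q).ne_zero ((mem_quadDivisors hp).1 hq)).symm
  have hreal : ∀ a ∈ realRootPairs p, Real.sign (resultant (toMonic (quadOfReal a))
      (p / toMonic (quadOfReal a))) = -(e a.1 * e a.2) := fun a ha =>
    sign_resultant_quadOfReal ((mem_realRootPairs hp.ne_zero).1 ha).2
      (hprod _ (Finset.mem_union_left _ (Finset.mem_image_of_mem _ ha)))
  have hcomplex : ∀ β ∈ upperRoots p, Real.sign (resultant (toMonic (quadOfComplex β))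
      (p / toMonic (quadOfComplex β))) = 1 := fun β hβ =>
    sign_resultant_quadOfComplex hp ((mem_upperRoots hp.ne_zero).1 hβ).2
      (hprod _ (Finset.mem_union_right _ (Finset.mem_image_of_mem _ hβ)))
  have hcard := card_roots_add_two_mul_card_upperRoots hp
  have hsum : ∑ x ∈ p.roots.toFinset, e x = 0 := by
    refine sum_sign_derivative_roots hp ?_
    rwa [← hcard, Nat.even_add, iff_true_right (even_two_mul _)] at heven
  have hsq : ∀ x ∈ p.roots.toFinset, e x ^ 2 = 1 := by
    intro x hx
    rw [Multiset.mem_toFinset, mem_roots hp.ne_zero, IsRoot] at hx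
    have hne := hp.eval₂_derivative_ne_zero (RingHom.id ℝ) hx
    rcases Real.sign_apply_eq_of_ne_zero _ hne with h | h
    · exact (congrArg (· ^ 2) h).trans (by norm_num)
    · exact (congrArg (· ^ 2) h).trans (by norm_num)
  have hpairs := two_mul_sum_filter_lt p.roots.toFinset e
  rw [← realRootPairs, hsum, Finset.sum_congr rfl hsq, Finset.sum_const, nsmul_one] at hpairs
  rw [sum_quadDivisors hp.ne_zero, Finset.sum_congr rfl hreal, Finset.sum_congr rfl hcomplex,
    Finset.sum_neg_distrib, Finset.sum_const, nsmul_one, ← hcard]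
  push_cast
  linear_combination (-1 / 2 : ℝ) * hpairs

theorem mulMonic_preimage_singleton {K : Type*} [Field K] {m n : ℕ} (b : Fin (m + n) → K) :
    mulMonic m n ⁻¹' {b} =
      (fun q => Fin.append q (toFn n (toMonic b / toMonic q))) '' {q | toMonic q ∣ toMonic b} := by
  ext v
  rw [Set.mem_preimage, Set.mem_singleton_iff, mulMonic_eq_iff, Set.mem_image]
  constructor
  · intro hv
    refine ⟨fun i => v (Fin.castAdd n i), Dvd.intro _ hv, ?_⟩
    rw [← hv, leftFactor, mul_div_cancel_left₀ _
      (monic_toMonic fun i => v (Fin.castAdd n i)).ne_zero, rightFactor,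
      toFn_toMonic, Fin.append_castAdd_natAdd]
  · rintro ⟨q, ⟨g, hg⟩, rfl⟩
    have hgm : g.Monic := (monic_toMonic q).of_mul_monic_left (hg ▸ monic_toMonic b)
    have hgn : g.natDegree = n := by
      have hdeg := congrArg natDegree hg
      rw [(monic_toMonic q).natDegree_mul hgm, natDegree_toMonic, natDegree_toMonic] at hdeg
      omega
    rw [leftFactor_append, rightFactor_append, hg, mul_div_cancel_left₀ _ (monic_toMonic q).ne_zero,
      toMonic_toFn hgm hgn]

theorem hasSignedFiberCard_mulMonic_two {n : ℕ} (hn : Even n) {b : Fin (2 + n) → ℝ}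
    (hb : Squarefree (toMonic b)) :
    HasSignedFiberCard (mulMonic 2 n) (mulMonicDeriv 2 n) ((2 + n) ^ 2) ((2 + n : ℕ) / 2) b := by
  have hsep : (toMonic b).Separable := PerfectField.separable_iff_squarefree.2 hb
  have hdeg : (toMonic b).natDegree = 2 + n := natDegree_toMonic b
  set θ : (Fin 2 → ℝ) → Fin (2 + n) → ℝ :=
    fun q => Fin.append q (toFn n (toMonic b / toMonic q)) with hθ
  have hθ_inj : Function.Injective θ := by
    intro q r h
    ext i
    simpa only [hθ, Fin.append_left] using congrFun h (Fin.castAdd n i)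
  have hdivisors : (quadDivisors (toMonic b) : Set (Fin 2 → ℝ)) = {q | toMonic q ∣ toMonic b} :=
    Set.ext fun q => mem_quadDivisors hsep
  have hpre := mulMonic_preimage_singleton b
  have hdet : ∀ q ∈ quadDivisors (toMonic b), (mulMonicDeriv 2 n (θ q)).det =
      resultant (toMonic q) (toMonic b / toMonic q) := by
    intro q hq
    have hmem : θ q ∈ mulMonic 2 n ⁻¹' {b} := hpre ▸ ⟨q, (mem_quadDivisors hsep).1 hq, rfl⟩
    have hleft : leftFactor (θ q) = toMonic q := leftFactor_append _ _
    have hmul : toMonic q * rightFactor (θ q) = toMonic b := hleft ▸ mulMonic_eq_iff.1 hmem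
    have hright : rightFactor (θ q) = toMonic b / toMonic q := by
      rw [← hmul, mul_div_cancel_left₀ _ (monic_toMonic q).ne_zero]
    rw [det_mulMonicDeriv, hleft, hright]
  refine ⟨(quadDivisors (toMonic b)).image θ, ?_, ?_, ?_⟩
  · rw [Finset.coe_image, hdivisors, hpre]
  · exact Finset.card_image_le.trans ((card_quadDivisors_le hsep).trans_eq (by rw [hdeg]))
  · rw [Finset.sum_image hθ_inj.injOn, Finset.sum_congr rfl fun q hq => congrArg _ (hdet q hq),
      sum_sign_resultant_quadDivisors hsep (by rw [hdeg]; exact even_two.add hn), hdeg]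

end FiberCount

section Append

/-- Concatenation of vectors, as a measurable equivalence. -/
noncomputable def appendMeasurableEquiv (m n : ℕ) :
    ((Fin m → ℝ) × (Fin n → ℝ)) ≃ᵐ (Fin (m + n) → ℝ) :=
  (MeasurableEquiv.sumPiEquivProdPi fun _ : Fin m ⊕ Fin n => ℝ).symm.trans
    (MeasurableEquiv.piCongrLeft (fun _ => ℝ) finSumFinEquiv)

theorem appendMeasurableEquiv_apply {m n : ℕ} (p : (Fin m → ℝ) × (Fin n → ℝ)) :
    appendMeasurableEquiv m n p = Fin.append p.1 p.2 := by
  funext i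
  obtain ⟨j, rfl⟩ := finSumFinEquiv.surjective i
  rw [appendMeasurableEquiv, MeasurableEquiv.trans_apply, MeasurableEquiv.coe_piCongrLeft,
    Equiv.piCongrLeft_apply_apply]
  cases j <;> simp [MeasurableEquiv.sumPiEquivProdPi, Equiv.sumPiEquivProdPi]

theorem measurePreserving_appendMeasurableEquiv (m n : ℕ) :
    MeasurePreserving (appendMeasurableEquiv m n) :=
  (volume_measurePreserving_piCongrLeft (fun _ => ℝ) finSumFinEquiv).comp
    (volume_measurePreserving_sumPiEquivProdPi_symm fun _ => ℝ)

theorem det_mulMonicDeriv_append {m n : ℕ} (p : (Fin m → ℝ) × (Fin n → ℝ)) :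
    (mulMonicDeriv m n (appendMeasurableEquiv m n p)).det =
      resultant (toMonic p.1) (toMonic p.2) := by
  rw [det_mulMonicDeriv, appendMeasurableEquiv_apply, leftFactor_append, rightFactor_append]

theorem toMonic_mulMonic_append {m n : ℕ} (p : (Fin m → ℝ) × (Fin n → ℝ)) :
    toMonic (mulMonic m n (appendMeasurableEquiv m n p)) = toMonic p.1 * toMonic p.2 := by
  rw [toMonic_mulMonic, appendMeasurableEquiv_apply, leftFactor_append, rightFactor_append]

theorem measurable_resultant_toMonic (m n : ℕ) :
    Measurable fun p : (Fin m → ℝ) × (Fin n → ℝ) => resultant (toMonic p.1) (toMonic p.2) := by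
  have h := (measurable_det_of_hasFDerivAt (hasFDerivAt_mulMonic (m := m) (n := n))).comp
    (appendMeasurableEquiv m n).measurable
  simpa only [Function.comp_def, det_mulMonicDeriv_append] using h

end Append

section QuadraticFactor

variable {n N : ℕ}

theorem ae_hasSignedFiberCard_mulMonic_two (hn : Even n) :
    ∀ᵐ b, HasSignedFiberCard (mulMonic 2 n) (mulMonicDeriv 2 n)
      ((2 + n) ^ 2) ((2 + n : ℕ) / 2) b :=
  (ae_squarefree_toMonic (2 + n)).mono fun _ => hasSignedFiberCard_mulMonic_two hn

theorem lintegral_enorm_resultant_mul_le (hn : Even n) (hN : 2 + n = N) {g : ℝ[X] → ENNReal}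
    (hg : Measurable fun c : Fin N → ℝ => g (toMonic c)) :
    ∫⁻ p : (Fin 2 → ℝ) × (Fin n → ℝ),
        ‖resultant (toMonic p.1) (toMonic p.2)‖ₑ * g (toMonic p.1 * toMonic p.2) ≤
      (N ^ 2 : ℕ) * ∫⁻ c : Fin N → ℝ, g (toMonic c) := by
  subst hN
  have h := lintegral_enorm_det_mul_comp_le (μ := volume) hasFDerivAt_mulMonic
    (ae_hasSignedFiberCard_mulMonic_two hn) hg
  rw [← (measurePreserving_appendMeasurableEquiv 2 n).lintegral_comp_emb
    (appendMeasurableEquiv 2 n).measurableEmbedding] at h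
  simpa only [det_mulMonicDeriv_append, toMonic_mulMonic_append] using h

theorem integral_resultant_mul (hn : Even n) (hN : 2 + n = N) {f : ℝ[X] → ℂ}
    (hf : Integrable fun c : Fin N → ℝ => f (toMonic c)) :
    Integrable (fun p : (Fin 2 → ℝ) × (Fin n → ℝ) =>
      ((resultant (toMonic p.1) (toMonic p.2) : ℝ) : ℂ) * f (toMonic p.1 * toMonic p.2)) ∧
    ∫ p : (Fin 2 → ℝ) × (Fin n → ℝ),
      ((resultant (toMonic p.1) (toMonic p.2) : ℝ) : ℂ) * f (toMonic p.1 * toMonic p.2) =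
        N / 2 * ∫ c : Fin N → ℝ, f (toMonic c) := by
  subst hN
  obtain ⟨hint, hval⟩ := integral_det_smul_comp (μ := volume) hasFDerivAt_mulMonic
    (ae_hasSignedFiberCard_mulMonic_two hn) hf
  have hmp := measurePreserving_appendMeasurableEquiv 2 n
  have he := (appendMeasurableEquiv 2 n).measurableEmbedding
  rw [← hmp.integrable_comp_emb he] at hint
  rw [← hmp.integral_comp he] at hval
  simp only [Function.comp_def, det_mulMonicDeriv_append, toMonic_mulMonic_append,
    Complex.real_smul] at hint hval
  push_cast at hval ⊢
  exact ⟨hint, hval⟩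

end QuadraticFactor

section FinCons

variable {α : Type*} [MeasureSpace α] [SigmaFinite (volume : Measure α)] {J : ℕ}

theorem measurePreserving_finCons :
    MeasurePreserving fun p : α × (Fin J → α) => (Fin.cons p.1 p.2 : Fin (J + 1) → α) := by
  have h := (volume_preserving_piFinSuccAbove (fun _ : Fin (J + 1) => α) 0).symm
  convert h using 2 with p
  simp [MeasurableEquiv.piFinSuccAbove, Fin.insertNthEquiv]

theorem lintegral_fin_succ {F : (Fin (J + 1) → α) → ENNReal} (hF : Measurable F) :
    ∫⁻ q, F q = ∫⁻ a, ∫⁻ r, F (Fin.cons a r) := by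
  rw [← measurePreserving_finCons.lintegral_comp hF]
  exact lintegral_prod _ (hF.comp measurePreserving_finCons.measurable).aemeasurable

theorem integral_fin_succ {F : (Fin (J + 1) → α) → ℂ} (hF : Integrable F) :
    ∫ q, F q = ∫ a, ∫ r, F (Fin.cons a r) := by
  have hcomp := measurePreserving_finCons.integrable_comp_of_integrable hF
  rw [← measurePreserving_finCons.map_eq,
    integral_map measurePreserving_finCons.aemeasurable
      (by rw [measurePreserving_finCons.map_eq]; exact hF.aestronglyMeasurable)]
  exact integral_prod _ hcomp

end FinCons

section QuadraticFactorization

variable {J N : ℕ}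

theorem measurable_comp_of_measurable_coeff {Y Z : Type*} [MeasurableSpace Y] [MeasurableSpace Z]
    {f : ℝ[X] → Z} (hf : Measurable fun c : Fin N → ℝ => f (toMonic c)) {p : Y → ℝ[X]}
    (hp : ∀ k, Measurable fun y => (p y).coeff k) (hm : ∀ y, (p y).Monic)
    (hd : ∀ y, (p y).natDegree = N) : Measurable fun y => f (p y) := by
  have hcoeff : Measurable fun y => toFn N (p y) := measurable_pi_iff.2 fun i => hp i
  simpa only [Function.comp_def, toMonic_toFn (hm _) (hd _)] using hf.comp hcoeff

theorem measurable_coeff_toMonic (k : ℕ) :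
    Measurable fun c : Fin N → ℝ => (toMonic c).coeff k := by
  simp only [toMonic, coeff_add]
  exact ((lcoeff ℝ k ∘ₗ polyOfCoeffs N).continuous_of_finiteDimensional.const_add _).measurable

theorem measurable_coeff_mul {Y : Type*} [MeasurableSpace Y] {f g : Y → ℝ[X]}
    (hf : ∀ k, Measurable fun y => (f y).coeff k) (hg : ∀ k, Measurable fun y => (g y).coeff k)
    (k : ℕ) : Measurable fun y => (f y * g y).coeff k := by
  simp only [coeff_mul]
  exact Finset.measurable_fun_sum _ fun ij _ => (hf ij.1).mul (hg ij.2)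

theorem measurable_coeff_prod {Y ι : Type*} [MeasurableSpace Y] (s : Finset ι) {f : ι → Y → ℝ[X]}
    (hf : ∀ i k, Measurable fun y => (f i y).coeff k) (k : ℕ) :
    Measurable fun y => (∏ i ∈ s, f i y).coeff k := by
  simp only [← Finset.prod_apply]
  exact Finset.prod_induction f (fun p => ∀ k, Measurable fun y => (p y).coeff k)
    (fun _ _ => measurable_coeff_mul) (fun _ => measurable_const) (fun i _ => hf i) k

/-- The product of the resultants of pairs of quadratic factors. -/
noncomputable def resultantProd (q : Fin J → Fin 2 → ℝ) : ℝ :=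
  ∏ i, ∏ j ∈ Finset.Ioi i, resultant (toMonic (q i)) (toMonic (q j))

theorem resultantProd_cons (q : Fin 2 → ℝ) (r : Fin J → Fin 2 → ℝ) :
    resultantProd (Fin.cons q r : Fin (J + 1) → Fin 2 → ℝ) =
      resultant (toMonic q) (∏ i, toMonic (r i)) * resultantProd r := by
  have hlead : ∏ i : Fin J, (toMonic (r i)).leadingCoeff ≠ 0 := by
    rw [Finset.prod_eq_one fun i _ => monic_toMonic (r i)]
    exact one_ne_zero
  rw [resultantProd, Fin.prod_univ_succ, Fin.prod_Ioi_zero]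
  simp only [Fin.prod_Ioi_succ]
  rw [resultant_prod_right _ _ _ _ le_rfl hlead]
  rfl

theorem measurable_resultantProd : Measurable (resultantProd (J := J)) := by
  unfold resultantProd
  refine Finset.measurable_fun_prod _ fun i _ => Finset.measurable_fun_prod _ fun j _ => ?_
  have hpair : Measurable fun q : Fin J → Fin 2 → ℝ => (q i, q j) :=
    (measurable_pi_apply i).prodMk (measurable_pi_apply j)
  have hres := (measurable_resultant_toMonic 2 2).comp hpair
  exact hres

theorem measurable_comp_prod_toMonic {Z : Type*} [MeasurableSpace Z] {f : ℝ[X] → Z}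
    (hf : Measurable fun c : Fin (2 * J) → ℝ => f (toMonic c)) :
    Measurable fun q : Fin J → Fin 2 → ℝ => f (∏ i, toMonic (q i)) := by
  refine measurable_comp_of_measurable_coeff hf
    (measurable_coeff_prod _ fun i k => (measurable_coeff_toMonic k).comp (measurable_pi_apply i))
    (fun q => monic_prod_of_monic _ _ fun i _ => monic_toMonic (q i)) fun q => ?_
  rw [natDegree_prod_of_monic _ _ fun i _ => monic_toMonic (q i)]
  simp [natDegree_toMonic, mul_comm]

theorem measurable_comp_mul_toMonic {m n : ℕ} {Z : Type*} [MeasurableSpace Z] {f : ℝ[X] → Z}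
    (hN : m + n = N) (hf : Measurable fun c : Fin N → ℝ => f (toMonic c)) :
    Measurable fun p : (Fin m → ℝ) × (Fin n → ℝ) => f (toMonic p.1 * toMonic p.2) := by
  refine measurable_comp_of_measurable_coeff hf
    (measurable_coeff_mul (fun k => (measurable_coeff_toMonic k).comp measurable_fst)
      fun k => (measurable_coeff_toMonic k).comp measurable_snd)
    (fun p => (monic_toMonic p.1).mul (monic_toMonic p.2)) fun p => ?_
  rw [(monic_toMonic p.1).natDegree_mul (monic_toMonic p.2), natDegree_toMonic, natDegree_toMonic,
    hN]

theorem lintegral_enorm_resultantProd_mul_le (J : ℕ) : ∃ K : ℕ, ∀ g : ℝ[X] → ENNReal,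
    (Measurable fun c : Fin (2 * J) → ℝ => g (toMonic c)) →
    ∫⁻ q : Fin J → Fin 2 → ℝ, ‖resultantProd q‖ₑ * g (∏ i, toMonic (q i)) ≤
      K * ∫⁻ c : Fin (2 * J) → ℝ, g (toMonic c) := by
  induction J with
  | zero =>
    refine ⟨1, fun g _ => le_of_eq ?_⟩
    simp [resultantProd, toMonic, polyOfCoeffs_apply, volume_pi]
  | succ J ih =>
    obtain ⟨K, hK⟩ := ih
    refine ⟨K * (2 * (J + 1)) ^ 2, fun g hg => ?_⟩
    have hN : 2 + 2 * J = 2 * (J + 1) := by ring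
    have hmeas : Measurable fun p : (Fin 2 → ℝ) × (Fin (2 * J) → ℝ) =>
        ‖resultant (toMonic p.1) (toMonic p.2)‖ₑ * g (toMonic p.1 * toMonic p.2) :=
      (measurable_resultant_toMonic _ _).enorm.mul (measurable_comp_mul_toMonic hN hg)
    calc ∫⁻ q : Fin (J + 1) → Fin 2 → ℝ, ‖resultantProd q‖ₑ * g (∏ i, toMonic (q i))
        = ∫⁻ a : Fin 2 → ℝ, ∫⁻ r : Fin J → Fin 2 → ℝ, ‖resultantProd r‖ₑ *
            (‖resultant (toMonic a) (∏ i, toMonic (r i))‖ₑ *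
              g (toMonic a * ∏ i, toMonic (r i))) := by
          refine (lintegral_fin_succ
            (measurable_resultantProd.enorm.mul (measurable_comp_prod_toMonic hg))).trans ?_
          simp only [Pi.mul_apply, resultantProd_cons, Fin.prod_univ_succ, Fin.cons_zero,
            Fin.cons_succ, enorm_mul, mul_assoc, mul_left_comm]
      _ ≤ ∫⁻ a : Fin 2 → ℝ, K * ∫⁻ c : Fin (2 * J) → ℝ,
            ‖resultant (toMonic a) (toMonic c)‖ₑ * g (toMonic a * toMonic c) := by
          refine lintegral_mono fun a => ?_
          have hslice := hmeas.comp (measurable_prodMk_left (x := a))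
          exact hK (fun p => ‖resultant (toMonic a) p‖ₑ * g (toMonic a * p)) hslice
      _ = K * ∫⁻ p : (Fin 2 → ℝ) × (Fin (2 * J) → ℝ),
            ‖resultant (toMonic p.1) (toMonic p.2)‖ₑ * g (toMonic p.1 * toMonic p.2) := by
          rw [lintegral_const_mul' _ _ (ENNReal.natCast_ne_top K), Measure.volume_eq_prod,
            lintegral_prod _ hmeas.aemeasurable]
      _ ≤ (K * (2 * (J + 1)) ^ 2 : ℕ) * ∫⁻ c : Fin (2 * (J + 1)) → ℝ, g (toMonic c) := by
          rw [Nat.cast_mul, mul_assoc]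
          gcongr
          exact lintegral_enorm_resultant_mul_le (even_two_mul J) hN hg

theorem integrable_resultantProd_mul {f : ℝ[X] → ℂ}
    (hfm : Measurable fun c : Fin (2 * J) → ℝ => f (toMonic c))
    (hfi : Integrable fun c : Fin (2 * J) → ℝ => f (toMonic c)) :
    Integrable fun q : Fin J → Fin 2 → ℝ => (resultantProd q : ℂ) * f (∏ i, toMonic (q i)) := by
  refine ⟨((Complex.measurable_ofReal.comp measurable_resultantProd).mul
    (measurable_comp_prod_toMonic hfm)).aestronglyMeasurable, ?_⟩
  obtain ⟨K, hK⟩ := lintegral_enorm_resultantProd_mul_le J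
  refine lt_of_eq_of_lt (lintegral_congr fun q => ?_) ((hK (fun p => ‖f p‖ₑ) hfm.enorm).trans_lt
    (ENNReal.mul_lt_top (ENNReal.natCast_lt_top K) hfi.2))
  rw [enorm_mul, enorm_eq_nnnorm (_ : ℂ), Complex.nnnorm_real, ← enorm_eq_nnnorm]

theorem integral_resultantProd_mul {f : ℝ[X] → ℂ}
    (hfm : Measurable fun c : Fin (2 * J) → ℝ => f (toMonic c))
    (hfi : Integrable fun c : Fin (2 * J) → ℝ => f (toMonic c)) :
    ∫ q : Fin J → Fin 2 → ℝ, (resultantProd q : ℂ) * f (∏ i, toMonic (q i)) =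
      J.factorial * ∫ c : Fin (2 * J) → ℝ, f (toMonic c) := by
  induction J generalizing f with
  | zero =>
    simp [resultantProd, toMonic, polyOfCoeffs_apply, measureReal_def, volume_pi]
  | succ J ih =>
    have hN : 2 + 2 * J = 2 * (J + 1) := by ring
    obtain ⟨hint, hval⟩ := integral_resultant_mul (even_two_mul J) hN hfi
    have hmeas : Measurable fun p : (Fin 2 → ℝ) × (Fin (2 * J) → ℝ) =>
        ((resultant (toMonic p.1) (toMonic p.2) : ℝ) : ℂ) * f (toMonic p.1 * toMonic p.2) :=
      (Complex.measurable_ofReal.comp (measurable_resultant_toMonic _ _)).mul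
        (measurable_comp_mul_toMonic hN hfm)
    calc ∫ q : Fin (J + 1) → Fin 2 → ℝ, (resultantProd q : ℂ) * f (∏ i, toMonic (q i))
        = ∫ a : Fin 2 → ℝ, ∫ r : Fin J → Fin 2 → ℝ, (resultantProd r : ℂ) *
            (((resultant (toMonic a) (∏ i, toMonic (r i)) : ℝ) : ℂ) *
              f (toMonic a * ∏ i, toMonic (r i))) := by
          rw [integral_fin_succ (integrable_resultantProd_mul hfm hfi)]
          simp only [resultantProd_cons, Fin.prod_univ_succ, Fin.cons_zero, Fin.cons_succ,
            Complex.ofReal_mul, mul_assoc, mul_left_comm]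
      _ = ∫ a : Fin 2 → ℝ, J.factorial * ∫ c : Fin (2 * J) → ℝ,
            ((resultant (toMonic a) (toMonic c) : ℝ) : ℂ) * f (toMonic a * toMonic c) := by
          refine integral_congr_ae (hint.prod_right_ae.mono fun a ha => ?_)
          have hslice := hmeas.comp (measurable_prodMk_left (x := a))
          exact ih (f := fun p => ((resultant (toMonic a) p : ℝ) : ℂ) * f (toMonic a * p)) hslice ha
      _ = J.factorial * ∫ p : (Fin 2 → ℝ) × (Fin (2 * J) → ℝ),
            ((resultant (toMonic p.1) (toMonic p.2) : ℝ) : ℂ) * f (toMonic p.1 * toMonic p.2) := by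
          rw [integral_const_mul, Measure.volume_eq_prod, integral_prod _ hint]
      _ = (J + 1).factorial * ∫ c : Fin (2 * (J + 1)) → ℝ, f (toMonic c) := by
          rw [hval, Nat.factorial_succ]
          push_cast
          ring

end QuadraticFactorization

section PairedDeterminants

open Equiv

variable {κ R : Type*} [Fintype κ] [DecidableEq κ] [CommRing R]

theorem sum_perm_sign_mul_prod_antisymm (u : κ → Fin 2 → κ × Fin 2 → R) :
    ∑ σ : Perm (κ × Fin 2), ((Perm.sign σ : ℤ) : R) *
        ∏ k, (u k 0 (σ (k, 0)) * u k 1 (σ (k, 1)) - u k 0 (σ (k, 1)) * u k 1 (σ (k, 0))) =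
      2 ^ Fintype.card κ * (Matrix.of fun a b : κ × Fin 2 => u b.1 b.2 a).det := by
  have hexpand : ∀ σ : Perm (κ × Fin 2),
      ∏ k, (u k 0 (σ (k, 0)) * u k 1 (σ (k, 1)) - u k 0 (σ (k, 1)) * u k 1 (σ (k, 0))) =
      ∑ π : κ → Perm (Fin 2),
        ∏ k, (((Perm.sign (π k) : ℤ) : R) * ∏ r, u k r (σ (k, π k r))) := by
    intro σ
    rw [← Fintype.prod_sum fun k (π : Perm (Fin 2)) =>
      ((Perm.sign π : ℤ) : R) * ∏ r, u k r (σ (k, π r))]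
    refine Finset.prod_congr rfl fun k _ => ?_
    have hdet := Matrix.det_fin_two (Matrix.of fun c r : Fin 2 => u k r (σ (k, c)))
    simp only [Matrix.det_apply', Matrix.of_apply] at hdet
    rw [hdet, mul_comm (u k 0 (σ (k, 1)))]
  have hshift : ∀ π : κ → Perm (Fin 2),
      ∑ σ : Perm (κ × Fin 2), ((Perm.sign σ : ℤ) : R) *
        ∏ k, (((Perm.sign (π k) : ℤ) : R) * ∏ r, u k r (σ (k, π k r))) =
      (Matrix.of fun a b : κ × Fin 2 => u b.1 b.2 a).det := by
    intro π
    rw [Matrix.det_apply', ← Equiv.sum_comp (Equiv.mulRight (Equiv.prodCongrRight π)) fun σ =>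
      ((Perm.sign σ : ℤ) : R) * ∏ b, Matrix.of (fun a b : κ × Fin 2 => u b.1 b.2 a) (σ b) b]
    refine Finset.sum_congr rfl fun σ _ => ?_
    rw [Finset.prod_mul_distrib, ← mul_assoc, Fintype.prod_prod_type, Equiv.coe_mulRight,
      Perm.sign_mul, Perm.sign_prodCongrRight]
    push_cast
    rfl
  simp_rw [hexpand, Finset.mul_sum]
  rw [Finset.sum_comm, Finset.sum_congr rfl fun π _ => hshift π]
  simp [Fintype.card_perm]

theorem det_one_submatrix_prodMap_of_not_injective {φ : κ → κ} (hφ : ¬ Function.Injective φ) :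
    ((1 : Matrix (κ × Fin 2) (κ × Fin 2) R).submatrix id (Prod.map φ id)).det = 0 := by
  obtain ⟨k, l, hkl, hne⟩ := Function.not_injective_iff.1 hφ
  refine Matrix.det_zero_of_column_eq (i := (k, 0)) (j := (l, 0)) (by simp [hne]) fun a => ?_
  exact congrArg (fun m => (1 : Matrix (κ × Fin 2) (κ × Fin 2) R) a (m, 0)) hkl

theorem det_one_submatrix_prodMap_perm (ρ : Perm κ) :
    ((1 : Matrix (κ × Fin 2) (κ × Fin 2) R).submatrix id (Prod.map ρ id)).det = 1 := by
  have hcoe : Prod.map ρ id = Equiv.prodCongrLeft fun _ : Fin 2 => ρ := rfl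
  rw [hcoe, Matrix.det_permute', Matrix.det_one, mul_one, Perm.sign_prodCongrLeft]
  simp

theorem sum_prod_mul_det_one_submatrix_prodMap (M : κ → R) :
    ∑ φ : κ → κ, (∏ k, M (φ k)) *
        ((1 : Matrix (κ × Fin 2) (κ × Fin 2) R).submatrix id (Prod.map φ id)).det =
      (Fintype.card κ).factorial * ∏ j, M j := by
  have hperm : ∑ _ρ : Perm κ, ∏ j, M j = ∑ φ : κ → κ, (∏ k, M (φ k)) *
      ((1 : Matrix (κ × Fin 2) (κ × Fin 2) R).submatrix id (Prod.map φ id)).det := by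
    refine Finset.sum_of_injOn (fun ρ : Perm κ => (ρ : κ → κ))
      (DFunLike.coe_injective.injOn) (fun _ _ => Finset.mem_coe.2 (Finset.mem_univ _)) ?_ ?_
    · intro φ _ hφ
      rw [det_one_submatrix_prodMap_of_not_injective, mul_zero]
      exact fun hinj => hφ ⟨Equiv.ofBijective φ (Finite.injective_iff_bijective.1 hinj),
        Finset.mem_coe.2 (Finset.mem_univ _), rfl⟩
    · intro ρ _
      rw [det_one_submatrix_prodMap_perm, mul_one, Equiv.prod_comp ρ M]
  rw [← hperm, Finset.sum_const, Finset.card_univ, Fintype.card_perm, nsmul_eq_mul]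

theorem sum_perm_sign_mul_prod_skew_block {B : κ × Fin 2 → κ × Fin 2 → R} {M : κ → R}
    (h01 : ∀ i j, B (i, 0) (j, 1) = if i = j then M j else 0)
    (h10 : ∀ i j, B (j, 1) (i, 0) = -if i = j then M j else 0)
    (h00 : ∀ i j, B (i, 0) (j, 0) = 0) (h11 : ∀ i j, B (i, 1) (j, 1) = 0) :
    ∑ σ : Perm (κ × Fin 2), ((Perm.sign σ : ℤ) : R) * ∏ k, B (σ (k, 0)) (σ (k, 1)) =
      2 ^ Fintype.card κ * (Fintype.card κ).factorial * ∏ j, M j := by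
  let e : κ → Fin 2 → κ × Fin 2 → R := fun j r a => (1 : Matrix (κ × Fin 2) (κ × Fin 2) R) a (j, r)
  have hB : ∀ a b, B a b = ∑ j, M j * (e j 0 a * e j 1 b - e j 0 b * e j 1 a) := by
    rintro ⟨i, r⟩ ⟨j, t⟩
    fin_cases r <;> fin_cases t <;> simp [e, Matrix.one_apply, h00, h01, h10, h11]
  calc ∑ σ : Perm (κ × Fin 2), ((Perm.sign σ : ℤ) : R) * ∏ k, B (σ (k, 0)) (σ (k, 1))
      = ∑ φ : κ → κ, (∏ k, M (φ k)) * ∑ σ : Perm (κ × Fin 2), ((Perm.sign σ : ℤ) : R) *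
          ∏ k, (e (φ k) 0 (σ (k, 0)) * e (φ k) 1 (σ (k, 1)) -
            e (φ k) 0 (σ (k, 1)) * e (φ k) 1 (σ (k, 0))) := by
        simp_rw [hB, Fintype.prod_sum, Finset.mul_sum]
        rw [Finset.sum_comm]
        simp_rw [Finset.prod_mul_distrib, mul_left_comm]
    _ = 2 ^ Fintype.card κ * ∑ φ : κ → κ, (∏ k, M (φ k)) *
          ((1 : Matrix (κ × Fin 2) (κ × Fin 2) R).submatrix id (Prod.map φ id)).det := by
        simp_rw [sum_perm_sign_mul_prod_antisymm fun _ => e (_ : κ), mul_left_comm,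
          ← Finset.mul_sum]
        rfl
    _ = 2 ^ Fintype.card κ * (Fintype.card κ).factorial * ∏ j, M j := by
        rw [sum_prod_mul_det_one_submatrix_prodMap, mul_assoc]

end PairedDeterminants

section PairedVandermonde

variable {J : ℕ}

/-- The enumeration `(k, r) ↦ 2 * k + r` of the members of consecutive pairs. -/
def pairIndex (J : ℕ) : Fin J × Fin 2 ≃ Fin (2 * J) :=
  finProdFinEquiv.trans (finCongr (mul_comm J 2))

theorem pairIndex_val (a : Fin J × Fin 2) : (pairIndex J a : ℕ) = a.2 + 2 * a.1 := rfl

theorem pairIndex_fst (k : Fin J) : pairIndex J (k, 0) = pairFst k :=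
  Fin.ext (by simp [pairIndex_val, pairFst])

theorem pairIndex_snd (k : Fin J) : pairIndex J (k, 1) = pairSnd k :=
  Fin.ext (by simp [pairIndex_val, pairSnd, add_comm])

theorem prod_prod_Ioi_eq_prod_ite {ι A : Type*} [Fintype ι] [LinearOrder ι]
    [LocallyFiniteOrderTop ι] [CommMonoid A] (F : ι → ι → A) :
    ∏ i, ∏ j ∈ Finset.Ioi i, F i j = ∏ i, ∏ j, if i < j then F i j else 1 := by
  refine Finset.prod_congr rfl fun i _ => ?_
  rw [← Finset.prod_filter]
  congr 1
  ext j
  simp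

theorem prod_prod_Ioi_pairIndex {A : Type*} [CommMonoid A] (F : Fin (2 * J) → Fin (2 * J) → A) :
    ∏ i, ∏ j ∈ Finset.Ioi i, F i j =
      (∏ k, F (pairIndex J (k, 0)) (pairIndex J (k, 1))) * ∏ k, ∏ l ∈ Finset.Ioi k,
        ∏ r : Fin 2, ∏ t : Fin 2, F (pairIndex J (k, r)) (pairIndex J (l, t)) := by
  have hdiag : ∏ k, F (pairIndex J (k, 0)) (pairIndex J (k, 1)) =
      ∏ k, ∏ l, if k = l then F (pairIndex J (k, 0)) (pairIndex J (k, 1)) else 1 := by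
    simp only [Finset.prod_ite_eq, Finset.mem_univ, if_true]
  rw [prod_prod_Ioi_eq_prod_ite, prod_prod_Ioi_eq_prod_ite, hdiag, ← (pairIndex J).prod_comp]
  simp_rw [← (pairIndex J).prod_comp (fun _ => ite _ _ _), Fintype.prod_prod_type,
    Fin.prod_univ_two, ← Finset.prod_mul_distrib]
  refine Finset.prod_congr rfl fun k _ => Finset.prod_congr rfl fun l _ => ?_
  simp only [Fin.lt_def, pairIndex_val, Fin.val_zero, Fin.val_one]
  rcases lt_trichotomy (k : ℕ) (l : ℕ) with h | h | h
  · rw [if_pos (by omega), if_pos (by omega), if_pos (by omega), if_pos (by omega),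
      if_neg (by rintro rfl; omega), if_pos h, one_mul]
  · obtain rfl : k = l := Fin.ext h
    simp
  · rw [if_neg (by omega), if_neg (by omega), if_neg (by omega), if_neg (by omega),
      if_neg (by rintro rfl; omega), if_neg (by omega)]
    simp only [one_mul]

theorem det_eval_pairIndex {Q : Fin (2 * J) → ℂ[X]} (hQ : IsCompleteMonicFamily Q)
    (z : Fin J → Fin 2 → ℂ) :
    (Matrix.of fun a b : Fin J × Fin 2 => (Q (pairIndex J a)).eval (z b.1 b.2)).det =
      (∏ k, (z k 1 - z k 0)) * ∏ k, ∏ l ∈ Finset.Ioi k,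
        ∏ r : Fin 2, ∏ t : Fin 2, (z l t - z k r) := by
  set v : Fin (2 * J) → ℂ := fun i => z ((pairIndex J).symm i).1 ((pairIndex J).symm i).2
  have hmat : (Matrix.of fun a b : Fin J × Fin 2 => (Q (pairIndex J a)).eval (z b.1 b.2)) =
      (Matrix.of fun i j => (Q j).eval (v i)).transpose.submatrix (pairIndex J) (pairIndex J) := by
    ext a b
    simp [v]
  rw [hmat, Matrix.det_submatrix_equiv_self, Matrix.det_transpose,
    ← Matrix.det_eval_matrixOfPolynomials_eq_det_vandermonde v Q (fun i => (hQ i).2)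
      (fun i => (hQ i).1), Matrix.det_vandermonde, prod_prod_Ioi_pairIndex]
  simp only [v, Equiv.symm_apply_apply]

/-- The antisymmetrization of `P(x)Q(y)` divided by `y - x`, at the roots `x`, `y` of a quadratic
polynomial. -/
noncomputable def pairKernel (P Q : ℂ[X]) (q : Fin 2 → ℝ) : ℂ :=
  (P.eval (rootFst q) * Q.eval (rootSnd q) - P.eval (rootSnd q) * Q.eval (rootFst q)) /
    (rootSnd q - rootFst q)

theorem pairKernel_mul_sub (P Q : ℂ[X]) {q : Fin 2 → ℝ} (hq : quadDisc q ≠ 0) :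
    pairKernel P Q q * (rootSnd q - rootFst q) =
      P.eval (rootFst q) * Q.eval (rootSnd q) - P.eval (rootSnd q) * Q.eval (rootFst q) :=
  div_mul_cancel₀ _ (sub_ne_zero.2 (rootFst_ne_rootSnd hq).symm)

theorem ofReal_resultantProd (q : Fin J → Fin 2 → ℝ) :
    (resultantProd q : ℂ) = ∏ k, ∏ l ∈ Finset.Ioi k, ∏ r : Fin 2, ∏ t : Fin 2,
      (![rootFst (q l), rootSnd (q l)] t - ![rootFst (q k), rootSnd (q k)] r) := by
  rw [resultantProd]
  push_cast
  refine Finset.prod_congr rfl fun k _ => Finset.prod_congr rfl fun l _ => ?_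
  rw [resultant_toMonic_two, aeval_toMonic_two, aeval_toMonic_two]
  simp only [Fin.prod_univ_two, Matrix.cons_val_zero, Matrix.cons_val_one]
  ring

theorem two_pow_mul_resultantProd {Q : Fin (2 * J) → ℂ[X]} (hQ : IsCompleteMonicFamily Q)
    {q : Fin J → Fin 2 → ℝ} (hq : ∀ k, quadDisc (q k) ≠ 0) :
    2 ^ J * (resultantProd q : ℂ) =
      ∑ σ : Equiv.Perm (Fin J × Fin 2), ((Equiv.Perm.sign σ : ℤ) : ℂ) *
        ∏ k, pairKernel (Q (pairIndex J (σ (k, 0)))) (Q (pairIndex J (σ (k, 1)))) (q k) := by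
  set z : Fin J → Fin 2 → ℂ := fun k => ![rootFst (q k), rootSnd (q k)] with hz
  have hne : ∏ k, (rootSnd (q k) - rootFst (q k)) ≠ 0 :=
    Finset.prod_ne_zero_iff.2 fun k _ => sub_ne_zero.2 (rootFst_ne_rootSnd (hq k)).symm
  have hdet := sum_perm_sign_mul_prod_antisymm fun k r a => (Q (pairIndex J a)).eval (z k r)
  rw [det_eval_pairIndex hQ, Fintype.card_fin, hz, ← ofReal_resultantProd] at hdet
  refine mul_right_cancel₀ hne ?_
  calc 2 ^ J * (resultantProd q : ℂ) * ∏ k, (rootSnd (q k) - rootFst (q k))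
      = 2 ^ J * ((∏ k, (rootSnd (q k) - rootFst (q k))) * resultantProd q) := by ring
    _ = _ := hdet.symm
    _ = _ := by
      simp_rw [Finset.sum_mul, mul_assoc, ← Finset.prod_mul_distrib, pairKernel_mul_sub _ _ (hq _)]
      refine Finset.sum_congr rfl fun σ _ => congrArg _ (Finset.prod_congr rfl fun k _ => ?_)
      simp only [Matrix.cons_val_zero, Matrix.cons_val_one]
      ring

end PairedVandermonde

section DistanceFunction

variable {Φ : ℂ[X] → ℝ} {s : ℂ} {n : ℕ}

namespace IsMultiplicativeDistanceFunction

theorem pos (hΦ : IsMultiplicativeDistanceFunction Φ) {f : ℂ[X]} (hf : f ≠ 0) : 0 < Φ f :=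
  (hΦ.nonneg f).lt_of_ne fun h => hf ((hΦ.eq_zero_iff f).1 h.symm)

theorem map_one (hΦ : IsMultiplicativeDistanceFunction Φ) : Φ 1 = 1 := by
  have h := hΦ.map_mul 1 1
  rw [mul_one] at h
  exact (mul_eq_left₀ (hΦ.pos one_ne_zero).ne').1 h.symm

theorem exists_pos_mul_norm_le (hΦ : IsMultiplicativeDistanceFunction Φ) (n : ℕ) :
    ∃ c : ℝ, 0 < c ∧ ∀ v : Fin n → ℂ, c * ‖v‖ ≤ Φ (polyOfCoeffs n v) := by
  have hne : ∀ v : Fin n → ℂ, v ≠ 0 → polyOfCoeffs n v ≠ 0 := by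
    intro v hv h
    rw [← toFn_polyOfCoeffs v, h, map_zero] at hv
    exact hv rfl
  obtain ⟨c, hc, hle⟩ := (isCompact_sphere (0 : Fin n → ℂ) 1).exists_forall_le'
    (hΦ.continuous_coeff n).continuousOn (a := 0)
    fun v hv => hΦ.pos (hne v (ne_zero_of_mem_unit_sphere ⟨v, hv⟩))
  refine ⟨c, hc, fun v => ?_⟩
  rcases eq_or_ne v 0 with rfl | hv
  · simpa using hΦ.nonneg _
  · have hv0 : 0 < ‖v‖ := norm_pos_iff.2 hv
    have hunit : c ≤ Φ (polyOfCoeffs n ((‖v‖ : ℂ)⁻¹ • v)) :=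
      hle _ (by simp [norm_smul, hv0.ne'])
    rwa [map_smul, smul_eq_C_mul, hΦ.map_C_mul, norm_inv, Complex.norm_real, norm_norm,
      ← div_eq_inv_mul, le_div_iff₀ hv0] at hunit

end IsMultiplicativeDistanceFunction

theorem toMonic_eq_polyOfCoeffs_snoc {R : Type*} [CommRing R] (v : Fin n → R) :
    toMonic v = polyOfCoeffs (n + 1) (Fin.snoc v 1 : Fin (n + 1) → R) := by
  simp [toMonic, polyOfCoeffs_apply, Fin.sum_univ_castSucc, add_comm]

theorem X_sub_C_eq_toMonic {R : Type*} [CommRing R] (γ : R) :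
    X - C γ = toMonic fun _ : Fin 1 => -γ := by
  simp [toMonic, polyOfCoeffs_apply, sub_eq_add_neg]

theorem one_add_norm_le_two_mul_norm_snoc (v : Fin n → ℂ) :
    1 + ‖v‖ ≤ 2 * ‖(Fin.snoc v 1 : Fin (n + 1) → ℂ)‖ := by
  have hone : 1 ≤ ‖(Fin.snoc v 1 : Fin (n + 1) → ℂ)‖ := by
    simpa using norm_le_pi_norm (Fin.snoc v 1 : Fin (n + 1) → ℂ) (Fin.last n)
  have hinit : ‖v‖ ≤ ‖(Fin.snoc v 1 : Fin (n + 1) → ℂ)‖ :=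
    (pi_norm_le_iff_of_nonneg (norm_nonneg _)).2 fun i => by
      simpa using norm_le_pi_norm (Fin.snoc v 1 : Fin (n + 1) → ℂ) i.castSucc
  linarith

namespace IsMultiplicativeDistanceFunction

theorem exists_pos_mul_one_add_norm_le (hΦ : IsMultiplicativeDistanceFunction Φ) (n : ℕ) :
    ∃ c : ℝ, 0 < c ∧ ∀ v : Fin n → ℂ, c * (1 + ‖v‖) ≤ Φ (toMonic v) := by
  obtain ⟨c, hc, h⟩ := hΦ.exists_pos_mul_norm_le (n + 1)
  refine ⟨c / 2, half_pos hc, fun v => ?_⟩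
  rw [toMonic_eq_polyOfCoeffs_snoc]
  refine le_trans ?_ (h _)
  linarith [mul_le_mul_of_nonneg_left (one_add_norm_le_two_mul_norm_snoc v) hc.le]

theorem continuous_toMonic (hΦ : IsMultiplicativeDistanceFunction Φ) (n : ℕ) :
    Continuous fun v : Fin n → ℂ => Φ (toMonic v) := by
  simp only [toMonic_eq_polyOfCoeffs_snoc]
  exact (hΦ.continuous_coeff (n + 1)).comp
    (Continuous.finSnoc (A := fun _ => ℂ) continuous_id continuous_const)

end IsMultiplicativeDistanceFunction

/-- The weight `Φ(f)^(-s)` of a polynomial. The weight `φ(γ)^(-s)` of a root `γ` is that of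
`X - C γ`. -/
noncomputable def polyWeight (Φ : ℂ[X] → ℝ) (s : ℂ) (f : ℂ[X]) : ℂ := (Φ f : ℂ) ^ (-s)

namespace IsMultiplicativeDistanceFunction

theorem polyWeight_mul (hΦ : IsMultiplicativeDistanceFunction Φ) (s : ℂ) (f g : ℂ[X]) :
    polyWeight Φ s (f * g) = polyWeight Φ s f * polyWeight Φ s g := by
  rw [polyWeight, hΦ.map_mul, Complex.ofReal_mul,
    Complex.mul_cpow_ofReal_nonneg (hΦ.nonneg _) (hΦ.nonneg _)]
  rfl

theorem polyWeight_prod (hΦ : IsMultiplicativeDistanceFunction Φ) (s : ℂ) {ι : Type*}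
    (t : Finset ι) (p : ι → ℂ[X]) :
    polyWeight Φ s (∏ i ∈ t, p i) = ∏ i ∈ t, polyWeight Φ s (p i) := by
  classical
  induction t using Finset.induction_on with
  | empty => simp [polyWeight, hΦ.map_one]
  | insert a t ha ih => rw [Finset.prod_insert ha, Finset.prod_insert ha, hΦ.polyWeight_mul, ih]

theorem polyWeight_map_toMonic_two (hΦ : IsMultiplicativeDistanceFunction Φ) (s : ℂ)
    (q : Fin 2 → ℝ) : polyWeight Φ s ((toMonic q).map (algebraMap ℝ ℂ)) =
      polyWeight Φ s (X - C (rootFst q)) * polyWeight Φ s (X - C (rootSnd q)) := by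
  rw [map_toMonic_two, hΦ.polyWeight_mul]

theorem continuous_polyWeight_toMonic (hΦ : IsMultiplicativeDistanceFunction Φ) (s : ℂ) (n : ℕ) :
    Continuous fun v : Fin n → ℂ => polyWeight Φ s (toMonic v) :=
  (Complex.continuous_ofReal.comp (hΦ.continuous_toMonic n)).cpow continuous_const fun v =>
    Complex.ofReal_mem_slitPlane.2 (hΦ.pos (monic_toMonic v).ne_zero)

theorem continuous_polyWeight_map_toMonic (hΦ : IsMultiplicativeDistanceFunction Φ) (s : ℂ)
    (n : ℕ) :
    Continuous fun c : Fin n → ℝ => polyWeight Φ s ((toMonic c).map (algebraMap ℝ ℂ)) := by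
  simp only [map_toMonic, Complex.coe_algebraMap]
  exact (hΦ.continuous_polyWeight_toMonic s n).comp
    (continuous_pi fun i => Complex.continuous_ofReal.comp (continuous_apply i))

theorem exists_norm_polyWeight_toMonic_le (hΦ : IsMultiplicativeDistanceFunction Φ)
    (hs : 0 ≤ s.re) (n : ℕ) : ∃ D : ℝ, 0 ≤ D ∧ ∀ v : Fin n → ℂ,
      ‖polyWeight Φ s (toMonic v)‖ ≤ D * (1 + ‖v‖) ^ (-s.re) := by
  obtain ⟨c, hc, h⟩ := hΦ.exists_pos_mul_one_add_norm_le n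
  refine ⟨c ^ (-s.re), by positivity, fun v => ?_⟩
  rw [polyWeight, Complex.norm_cpow_eq_rpow_re_of_pos (hΦ.pos (monic_toMonic v).ne_zero),
    Complex.neg_re, ← Real.mul_rpow hc.le (by positivity)]
  exact Real.rpow_le_rpow_of_nonpos (by positivity) (h v) (neg_nonpos.2 hs)

theorem integrable_polyWeight_map_toMonic (hΦ : IsMultiplicativeDistanceFunction Φ)
    (hs : (n : ℝ) < s.re) :
    Integrable fun c : Fin n → ℝ => polyWeight Φ s ((toMonic c).map (algebraMap ℝ ℂ)) := by
  obtain ⟨D, -, h⟩ := hΦ.exists_norm_polyWeight_toMonic_le (n.cast_nonneg.trans hs.le) n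
  have hdom : Integrable fun v : Fin n → ℝ => (1 + ‖v‖) ^ (-s.re) :=
    integrable_one_add_norm (by simpa using hs)
  refine (hdom.const_mul D).mono'
    (hΦ.continuous_polyWeight_map_toMonic s n).aestronglyMeasurable (.of_forall fun v => ?_)
  have hnorm : ‖algebraMap ℝ ℂ ∘ v‖ = ‖v‖ := by simp [Pi.norm_def, nnnorm]
  simpa only [map_toMonic, hnorm] using h (algebraMap ℝ ℂ ∘ v)

end IsMultiplicativeDistanceFunction

/-- The function `φ(z)^(-s) P(z)`, in terms of which the skew form is an integral of products. -/
noncomputable def weightedEval (Φ : ℂ[X] → ℝ) (s : ℂ) (P : ℂ[X]) (z : ℂ) : ℂ :=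
  polyWeight Φ s (X - C z) * P.eval z

theorem exists_norm_eval_le (P : ℂ[X]) : ∃ D : ℝ, 0 ≤ D ∧ ∀ z : ℂ,
    ‖P.eval z‖ ≤ D * (1 + ‖z‖) ^ (P.natDegree : ℝ) := by
  refine ⟨∑ i ∈ Finset.range (P.natDegree + 1), ‖P.coeff i‖,
    Finset.sum_nonneg fun _ _ => norm_nonneg _, fun z => ?_⟩
  rw [eval_eq_sum_range, Finset.sum_mul, Real.rpow_natCast]
  refine (norm_sum_le _ _).trans (Finset.sum_le_sum fun i hi => ?_)
  rw [norm_mul, norm_pow]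
  refine mul_le_mul_of_nonneg_left ?_ (norm_nonneg _)
  calc ‖z‖ ^ i ≤ (1 + ‖z‖) ^ i := by gcongr; linarith
    _ ≤ (1 + ‖z‖) ^ P.natDegree :=
      pow_le_pow_right₀ (by linarith [norm_nonneg z]) (Finset.mem_range_succ_iff.1 hi)

namespace IsMultiplicativeDistanceFunction

theorem continuous_weightedEval (hΦ : IsMultiplicativeDistanceFunction Φ) (s : ℂ) (P : ℂ[X]) :
    Continuous (weightedEval Φ s P) := by
  unfold weightedEval
  simp only [X_sub_C_eq_toMonic]
  exact ((hΦ.continuous_polyWeight_toMonic s 1).comp (by fun_prop)).mul P.continuous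

theorem exists_norm_weightedEval_le (hΦ : IsMultiplicativeDistanceFunction Φ)
    (hs : 0 ≤ s.re) (P : ℂ[X]) : ∃ D : ℝ, 0 ≤ D ∧ ∀ z : ℂ,
      ‖weightedEval Φ s P z‖ ≤ D * (1 + ‖z‖) ^ (-(s.re - P.natDegree)) := by
  obtain ⟨c, hc, h⟩ := hΦ.exists_norm_polyWeight_toMonic_le hs 1
  obtain ⟨d, hd, hP⟩ := exists_norm_eval_le P
  refine ⟨c * d, by positivity, fun z => ?_⟩
  have hweight : ‖polyWeight Φ s (X - C z)‖ ≤ c * (1 + ‖z‖) ^ (-s.re) := by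
    simpa [X_sub_C_eq_toMonic, Pi.norm_def] using h fun _ => -z
  rw [weightedEval, norm_mul, neg_sub s.re, sub_eq_neg_add (P.natDegree : ℝ),
    Real.rpow_add (by positivity)]
  calc ‖polyWeight Φ s (X - C z)‖ * ‖P.eval z‖
      ≤ (c * (1 + ‖z‖) ^ (-s.re)) * (d * (1 + ‖z‖) ^ (P.natDegree : ℝ)) := by
        gcongr
        exact hP z
    _ = c * d * ((1 + ‖z‖) ^ (-s.re) * (1 + ‖z‖) ^ (P.natDegree : ℝ)) := by ring

theorem integrable_weightedEval (hΦ : IsMultiplicativeDistanceFunction Φ)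
    {P : ℂ[X]} (hP : P.natDegree + 1 < s.re) :
    Integrable fun x : ℝ => weightedEval Φ s P x := by
  obtain ⟨D, -, h⟩ := hΦ.exists_norm_weightedEval_le (le_trans (by positivity) hP.le) P
  have hdom : Integrable fun x : ℝ => (1 + ‖x‖) ^ (-(s.re - P.natDegree)) :=
    integrable_one_add_norm (by rw [Module.finrank_self]; push_cast; linarith)
  refine (hdom.const_mul D).mono' ((hΦ.continuous_weightedEval s P).comp
    Complex.continuous_ofReal).aestronglyMeasurable (.of_forall fun x => ?_)
  simpa using h x

theorem integrable_weightedEval_mul_conj (hΦ : IsMultiplicativeDistanceFunction Φ)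
    {P Q : ℂ[X]} (hP : P.natDegree + 1 < s.re) (hQ : Q.natDegree + 1 < s.re) :
    Integrable fun β : ℂ => weightedEval Φ s P (starRingEnd ℂ β) * weightedEval Φ s Q β := by
  have hs : 0 ≤ s.re := le_trans (by positivity) hP.le
  obtain ⟨D, hD, h⟩ := hΦ.exists_norm_weightedEval_le hs P
  obtain ⟨D', -, h'⟩ := hΦ.exists_norm_weightedEval_le hs Q
  have hdom : Integrable fun β : ℂ =>
      (1 + ‖β‖) ^ (-(s.re - P.natDegree) + -(s.re - Q.natDegree)) := by
    rw [← neg_add]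
    exact integrable_one_add_norm (by rw [Complex.finrank_real_complex]; push_cast; linarith)
  refine (hdom.const_mul (D * D')).mono' (((hΦ.continuous_weightedEval s P).comp
    Complex.continuous_conj).mul (hΦ.continuous_weightedEval s Q)).aestronglyMeasurable
    (.of_forall fun β => ?_)
  rw [norm_mul, Real.rpow_add (by positivity)]
  refine (mul_le_mul (Complex.norm_conj β ▸ h (starRingEnd ℂ β)) (h' β) (norm_nonneg _)
    (by positivity)).trans_eq ?_
  ring

end IsMultiplicativeDistanceFunction

end DistanceFunction

section ChangeOfVariables

theorem image_comp_symm_preimage {Y E F : Type*} (e : Y ≃ E) (f : Y → F) (t : Set Y) :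
    (f ∘ e.symm) '' (e.symm ⁻¹' t) = f '' t := by
  rw [Set.image_comp, Set.image_preimage_eq t e.symm.surjective]

variable {Y E F : Type*} [MeasurableSpace Y] {μ : Measure Y} [NormedAddCommGroup E]
  [NormedSpace ℝ E] [FiniteDimensional ℝ E] [MeasurableSpace E] [BorelSpace E] {ν : Measure E}
  [ν.IsAddHaarMeasure] [NormedAddCommGroup F] [NormedSpace ℝ F] {e : Y ≃ᵐ E} {f : Y → E}
  {f' : Y → E →L[ℝ] E} {t : Set Y}

theorem integrableOn_image_iff_of_measurePreserving (he : MeasurePreserving e μ ν)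
    (ht : MeasurableSet t) (hf : ∀ y ∈ t, HasFDerivAt (f ∘ e.symm) (f' y) (e y))
    (hinj : Set.InjOn f t) (g : E → F) :
    IntegrableOn g (f '' t) ν ↔ IntegrableOn (fun y => |(f' y).det| • g (f y)) t μ := by
  rw [← image_comp_symm_preimage e.toEquiv f t]
  refine (integrableOn_image_iff_integrableOn_abs_det_fderiv_smul ν (e.symm.measurable ht)
    (f' := fun x => f' (e.symm x)) (fun x hx => ?_)
    (hinj.comp e.symm.injective.injOn fun _ hx => hx) g).trans
    ((he.symm e).integrableOn_comp_preimage (f := fun y => |(f' y).det| • g (f y)) (s := t)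
      e.symm.measurableEmbedding)
  exact (e.apply_symm_apply x ▸ hf _ hx).hasFDerivWithinAt

theorem setIntegral_image_of_measurePreserving (he : MeasurePreserving e μ ν)
    (ht : MeasurableSet t) (hf : ∀ y ∈ t, HasFDerivAt (f ∘ e.symm) (f' y) (e y))
    (hinj : Set.InjOn f t) (g : E → F) :
    ∫ x in f '' t, g x ∂ν = ∫ y in t, |(f' y).det| • g (f y) ∂μ := by
  rw [← image_comp_symm_preimage e.toEquiv f t]
  refine (integral_image_eq_integral_abs_det_fderiv_smul ν (e.symm.measurable ht)
    (f' := fun x => f' (e.symm x)) (fun x hx => ?_)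
    (hinj.comp e.symm.injective.injOn fun _ hx => hx) g).trans
    ((he.symm e).setIntegral_preimage_emb e.symm.measurableEmbedding
      (fun y => |(f' y).det| • g (f y)) t)
  exact (e.apply_symm_apply x ▸ hf _ hx).hasFDerivWithinAt

end ChangeOfVariables

section Involution

variable {Y : Type*} [MeasurableSpace Y] {μ : Measure Y}

theorem integral_mul_sign_eq_setIntegral_sub {τ : Y ≃ᵐ Y} (hτ : MeasurePreserving τ μ μ)
    (hinv : ∀ y, τ (τ y) = y) {ε : Y → ℝ} (hε : Measurable ε) (hετ : ∀ y, ε (τ y) = -ε y)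
    {H : Y → ℂ} (hH : Integrable H μ) :
    ∫ y, H y * (Real.sign (ε y) : ℂ) ∂μ = ∫ y in {y | 0 < ε y}, (H y - H (τ y)) ∂μ := by
  set A := {y | 0 < ε y}
  have hA : MeasurableSet A := hε measurableSet_Ioi
  have hHτ : Integrable (fun y => H (τ y)) μ :=
    (hτ.integrable_comp_emb τ.measurableEmbedding).2 hH
  have hflip : Integrable (fun y => A.indicator (fun y => H (τ y)) (τ y)) μ :=
    (hτ.integrable_comp_emb τ.measurableEmbedding).2 (hHτ.indicator hA)
  have hsign : ∀ y, H y * (Real.sign (ε y) : ℂ) =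
      A.indicator H y - A.indicator (fun y => H (τ y)) (τ y) := by
    intro y
    simp only [A, Set.indicator_apply, Set.mem_ofPred_eq, hετ, hinv]
    rcases lt_trichotomy (ε y) 0 with h | h | h
    · simp [Real.sign_of_neg h, h.not_gt, h]
    · simp [h]
    · simp [Real.sign_of_pos h, h, h.not_gt]
  simp_rw [hsign]
  rw [integral_sub (hH.indicator hA) hflip, integral_sub hH.integrableOn hHτ.integrableOn,
    hτ.integral_comp τ.measurableEmbedding, integral_indicator hA, integral_indicator hA]

end Involution

section RootCoordinates

theorem hasFDerivAt_quadOfReal (p : ℝ × ℝ) :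
    HasFDerivAt (quadOfReal ∘ MeasurableEquiv.finTwoArrow)
      (Matrix.toLin' !![p.2, p.1; -1, -1]).toContinuousLinearMap
      (MeasurableEquiv.finTwoArrow.symm p) := by
  have h0 := hasFDerivAt_apply (𝕜 := ℝ) 0 (MeasurableEquiv.finTwoArrow.symm p)
  have h1 := hasFDerivAt_apply (𝕜 := ℝ) 1 (MeasurableEquiv.finTwoArrow.symm p)
  refine hasFDerivAt_pi'' fun i => ?_
  fin_cases i
  · refine (h0.mul h1).congr_fderiv (ContinuousLinearMap.ext fun w => ?_)
    simp [Matrix.vecHead, Matrix.vecTail]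
    ring
  · refine (h0.add h1).neg.congr_fderiv (ContinuousLinearMap.ext fun w => ?_)
    simp [Matrix.vecHead, Matrix.vecTail]
    ring

theorem hasFDerivAt_quadOfComplex (β : ℂ) :
    HasFDerivAt (quadOfComplex ∘ Complex.measurableEquivPi.symm)
      (Matrix.toLin' !![2 * β.re, 2 * β.im; -2, 0]).toContinuousLinearMap
      (Complex.measurableEquivPi β) := by
  have h0 := hasFDerivAt_apply (𝕜 := ℝ) 0 (Complex.measurableEquivPi β)
  have h1 := hasFDerivAt_apply (𝕜 := ℝ) 1 (Complex.measurableEquivPi β)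
  have hcoord : quadOfComplex ∘ Complex.measurableEquivPi.symm =
      fun v => ![v 0 ^ 2 + v 1 ^ 2, -(2 * v 0)] := by
    ext v i
    simp [quadOfComplex]
  rw [hcoord]
  refine hasFDerivAt_pi'' fun i => ?_
  fin_cases i
  · refine ((h0.pow 2).add (h1.pow 2)).congr_fderiv (ContinuousLinearMap.ext fun w => ?_)
    simp [Matrix.vecHead, Matrix.vecTail]
  · refine (h0.const_mul 2).neg.congr_fderiv (ContinuousLinearMap.ext fun w => ?_)
    simp [Matrix.vecHead, Matrix.vecTail]

theorem image_quadOfReal : quadOfReal '' {p | 0 < p.2 - p.1} = {q | 0 < quadDisc q} := by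
  ext q
  constructor
  · rintro ⟨p, hp, rfl⟩
    simpa only [Set.mem_ofPred_eq, quadDisc_quadOfReal] using pow_pos hp 2
  · intro hq
    obtain ⟨p, hp, rfl⟩ := exists_quadOfReal_eq hq
    exact ⟨p, sub_pos.2 hp, rfl⟩

theorem image_quadOfComplex : quadOfComplex '' {β | 0 < β.im} = {q | quadDisc q < 0} := by
  ext q
  constructor
  · rintro ⟨β, hβ, rfl⟩
    simpa only [Set.mem_ofPred_eq, quadDisc_quadOfComplex, neg_lt_zero] using
      pow_pos (mul_pos two_pos hβ) 2
  · intro hq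
    obtain ⟨β, hβ, rfl⟩ := exists_quadOfComplex_eq hq
    exact ⟨β, hβ, rfl⟩

end RootCoordinates

section SkewFormIntegral

variable {Φ : ℂ[X] → ℝ} {s : ℂ} {P Q : ℂ[X]}

theorem realSkewForm_eq (Φ : ℂ[X] → ℝ) (s : ℂ) (P Q : ℂ[X]) :
    realSkewForm Φ s P Q = ∫ p : ℝ × ℝ, weightedEval Φ s P p.1 * weightedEval Φ s Q p.2 *
      (Real.sign (p.2 - p.1) : ℂ) := by
  refine integral_congr_ae (.of_forall fun p => ?_)
  simp only [weightedEval, polyWeight, rootFunction]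
  ring

theorem complexSkewForm_eq (Φ : ℂ[X] → ℝ) (s : ℂ) (P Q : ℂ[X]) :
    complexSkewForm Φ s P Q = -2 * Complex.I * ∫ β : ℂ,
      weightedEval Φ s P (starRingEnd ℂ β) * weightedEval Φ s Q β * (Real.sign β.im : ℂ) := by
  rw [complexSkewForm]
  congr 1
  refine integral_congr_ae (.of_forall fun β => ?_)
  simp only [weightedEval, polyWeight, rootFunction]
  ring

/-- The weight of the quadratic polynomial `toMonic q` times `pairKernel P Q q`: the integrand whose
integral over all quadratics is the skew form of `P` and `Q`. -/
noncomputable def weightedPairKernel (Φ : ℂ[X] → ℝ) (s : ℂ) (P Q : ℂ[X]) (q : Fin 2 → ℝ) : ℂ :=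
  polyWeight Φ s ((toMonic q).map (algebraMap ℝ ℂ)) * pairKernel P Q q

theorem weightedPairKernel_mul_sub (hΦ : IsMultiplicativeDistanceFunction Φ) (s : ℂ) (P Q : ℂ[X])
    {q : Fin 2 → ℝ} (hq : quadDisc q ≠ 0) :
    weightedPairKernel Φ s P Q q * (rootSnd q - rootFst q) =
      weightedEval Φ s P (rootFst q) * weightedEval Φ s Q (rootSnd q) -
        weightedEval Φ s P (rootSnd q) * weightedEval Φ s Q (rootFst q) := by
  rw [weightedPairKernel, mul_assoc, pairKernel_mul_sub P Q hq, hΦ.polyWeight_map_toMonic_two]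
  simp only [weightedEval]
  ring

theorem abs_det_smul_weightedPairKernel_quadOfReal (hΦ : IsMultiplicativeDistanceFunction Φ) (s : ℂ)
    (P Q : ℂ[X]) {p : ℝ × ℝ} (hp : 0 < p.2 - p.1) :
    |(Matrix.toLin' !![p.2, p.1; -1, -1]).toContinuousLinearMap.det| •
        weightedPairKernel Φ s P Q (quadOfReal p) =
      weightedEval Φ s P p.1 * weightedEval Φ s Q p.2 -
        weightedEval Φ s P p.2 * weightedEval Φ s Q p.1 := by
  have hdet : |(Matrix.toLin' !![p.2, p.1; -1, -1]).toContinuousLinearMap.det| = p.2 - p.1 := by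
    rw [ContinuousLinearMap.det, LinearMap.coe_toContinuousLinearMap, LinearMap.det_toLin',
      Matrix.det_fin_two_of, ← abs_of_pos hp, ← abs_neg]
    ring_nf
  have hdisc : quadDisc (quadOfReal p) ≠ 0 := by
    rw [quadDisc_quadOfReal]
    exact (pow_pos hp 2).ne'
  have hkernel := weightedPairKernel_mul_sub hΦ s P Q hdisc
  rw [rootFst_quadOfReal (sub_pos.1 hp).le, rootSnd_quadOfReal (sub_pos.1 hp).le] at hkernel
  rw [hdet, Complex.real_smul, Complex.ofReal_sub, mul_comm, hkernel]

theorem abs_det_smul_weightedPairKernel_quadOfComplex (hΦ : IsMultiplicativeDistanceFunction Φ)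
    (s : ℂ) (P Q : ℂ[X]) {β : ℂ} (hβ : 0 < β.im) :
    |(Matrix.toLin' !![2 * β.re, 2 * β.im; -2, 0]).toContinuousLinearMap.det| •
        weightedPairKernel Φ s P Q (quadOfComplex β) =
      -2 * Complex.I * (weightedEval Φ s P (starRingEnd ℂ β) * weightedEval Φ s Q β -
        weightedEval Φ s P β * weightedEval Φ s Q (starRingEnd ℂ β)) := by
  have hdet : |(Matrix.toLin' !![2 * β.re, 2 * β.im; -2, 0]).toContinuousLinearMap.det| =
      4 * β.im := by
    rw [ContinuousLinearMap.det, LinearMap.coe_toContinuousLinearMap, LinearMap.det_toLin',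
      Matrix.det_fin_two_of, ← abs_of_pos (mul_pos four_pos hβ)]
    ring_nf
  have hdisc : quadDisc (quadOfComplex β) ≠ 0 := by
    rw [quadDisc_quadOfComplex]
    exact neg_ne_zero.2 (pow_pos (mul_pos two_pos hβ) 2).ne'
  have hkernel := weightedPairKernel_mul_sub hΦ s P Q hdisc
  rw [rootFst_quadOfComplex hβ.le, rootSnd_quadOfComplex hβ.le, Complex.sub_conj] at hkernel
  rw [hdet, Complex.real_smul, ← hkernel]
  push_cast
  linear_combination (4 * β.im * weightedPairKernel Φ s P Q (quadOfComplex β)) * Complex.I_sq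

theorem integrableOn_weightedPairKernel_quadDisc_pos (hΦ : IsMultiplicativeDistanceFunction Φ)
    (hP : (P.natDegree : ℝ) + 1 < s.re) (hQ : (Q.natDegree : ℝ) + 1 < s.re) :
    IntegrableOn (weightedPairKernel Φ s P Q) {q | 0 < quadDisc q} ∧
      ∫ q in {q | 0 < quadDisc q}, weightedPairKernel Φ s P Q q = realSkewForm Φ s P Q := by
  have hε : Measurable fun p : ℝ × ℝ => p.2 - p.1 := by fun_prop
  have ht : MeasurableSet {p : ℝ × ℝ | 0 < p.2 - p.1} := hε measurableSet_Ioi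
  have he := (volume_preserving_finTwoArrow ℝ).symm
  have hd : ∀ p ∈ {p : ℝ × ℝ | 0 < p.2 - p.1}, HasFDerivAt
      (quadOfReal ∘ MeasurableEquiv.finTwoArrow.symm.symm) _
      (MeasurableEquiv.finTwoArrow.symm p) := fun p _ => hasFDerivAt_quadOfReal p
  have hH : Integrable fun p : ℝ × ℝ => weightedEval Φ s P p.1 * weightedEval Φ s Q p.2 :=
    (hΦ.integrable_weightedEval hP).mul_prod (hΦ.integrable_weightedEval hQ)
  have hval := fun p (hp : p ∈ {p : ℝ × ℝ | 0 < p.2 - p.1}) =>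
    abs_det_smul_weightedPairKernel_quadOfReal hΦ s P Q hp
  rw [← image_quadOfReal, integrableOn_image_iff_of_measurePreserving he ht hd injOn_quadOfReal,
    setIntegral_image_of_measurePreserving he ht hd injOn_quadOfReal,
    integrableOn_congr_fun hval ht, setIntegral_congr_fun ht hval]
  refine ⟨(hH.sub hH.swap).integrableOn, ?_⟩
  have hswap : MeasurePreserving (MeasurableEquiv.prodComm : ℝ × ℝ ≃ᵐ ℝ × ℝ) volume volume :=
    Measure.measurePreserving_swap
  rw [realSkewForm_eq, integral_mul_sign_eq_setIntegral_sub hswap (fun p => p.swap_swap) hε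
    (fun p => (neg_sub _ _).symm) hH]
  rfl

theorem integrableOn_weightedPairKernel_quadDisc_neg (hΦ : IsMultiplicativeDistanceFunction Φ)
    (hP : (P.natDegree : ℝ) + 1 < s.re) (hQ : (Q.natDegree : ℝ) + 1 < s.re) :
    IntegrableOn (weightedPairKernel Φ s P Q) {q | quadDisc q < 0} ∧
      ∫ q in {q | quadDisc q < 0}, weightedPairKernel Φ s P Q q = complexSkewForm Φ s P Q := by
  have ht : MeasurableSet {β : ℂ | 0 < β.im} := Complex.measurable_im measurableSet_Ioi
  have he := Complex.volume_preserving_equiv_pi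
  have hconj : MeasurePreserving Complex.conjLIE.toMeasurableEquiv :=
    Complex.conjLIE.measurePreserving
  have hd : ∀ β ∈ {β : ℂ | 0 < β.im}, HasFDerivAt (quadOfComplex ∘ Complex.measurableEquivPi.symm) _
      (Complex.measurableEquivPi β) := fun β _ => hasFDerivAt_quadOfComplex β
  have hH := hΦ.integrable_weightedEval_mul_conj hP hQ
  have hHconj : Integrable fun β =>
      weightedEval Φ s P β * weightedEval Φ s Q (starRingEnd ℂ β) := by
    simpa only [mul_comm] using hΦ.integrable_weightedEval_mul_conj hQ hP
  have hval := fun β (hβ : β ∈ {β : ℂ | 0 < β.im}) =>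
    abs_det_smul_weightedPairKernel_quadOfComplex hΦ s P Q hβ
  rw [← image_quadOfComplex, integrableOn_image_iff_of_measurePreserving he ht hd
      injOn_quadOfComplex, setIntegral_image_of_measurePreserving he ht hd injOn_quadOfComplex,
    integrableOn_congr_fun hval ht, setIntegral_congr_fun ht hval]
  refine ⟨((hH.sub hHconj).const_mul _).integrableOn, ?_⟩
  rw [complexSkewForm_eq, integral_mul_sign_eq_setIntegral_sub hconj Complex.conj_conj
    Complex.measurable_im Complex.conj_im hH, integral_const_mul]
  simp only [LinearIsometryEquiv.coe_toMeasurableEquiv, Complex.conjLIE_apply, Complex.conj_conj]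

theorem continuous_quadDisc : Continuous quadDisc := by
  unfold quadDisc
  fun_prop

theorem ae_quadDisc_ne_zero : ∀ᵐ q : Fin 2 → ℝ, quadDisc q ≠ 0 := by
  filter_upwards [ae_squarefree_toMonic 2] with q hq
  exact quadDisc_ne_zero_of_dvd (PerfectField.separable_iff_squarefree.2 hq) dvd_rfl

theorem quadDisc_pos_union_neg_ae_eq_univ :
    ({q | 0 < quadDisc q} ∪ {q | quadDisc q < 0} : Set (Fin 2 → ℝ)) =ᵐ[volume] Set.univ := by
  filter_upwards [ae_quadDisc_ne_zero] with q hq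
  exact propext ⟨fun _ => trivial, fun _ => hq.lt_or_gt.symm⟩

theorem integrable_weightedPairKernel (hΦ : IsMultiplicativeDistanceFunction Φ)
    (hP : (P.natDegree : ℝ) + 1 < s.re) (hQ : (Q.natDegree : ℝ) + 1 < s.re) :
    Integrable (weightedPairKernel Φ s P Q) := by
  rw [← integrableOn_univ, ← integrableOn_congr_set_ae quadDisc_pos_union_neg_ae_eq_univ]
  exact (integrableOn_weightedPairKernel_quadDisc_pos hΦ hP hQ).1.union
    (integrableOn_weightedPairKernel_quadDisc_neg hΦ hP hQ).1

theorem integral_weightedPairKernel (hΦ : IsMultiplicativeDistanceFunction Φ)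
    (hP : (P.natDegree : ℝ) + 1 < s.re) (hQ : (Q.natDegree : ℝ) + 1 < s.re) :
    ∫ q, weightedPairKernel Φ s P Q q = skewForm Φ s P Q := by
  have hdisj : Disjoint {q | 0 < quadDisc q} {q | quadDisc q < 0} :=
    Set.disjoint_left.2 fun q (h : 0 < quadDisc q) (h' : quadDisc q < 0) => lt_asymm h h'
  obtain ⟨hint, hval⟩ := integrableOn_weightedPairKernel_quadDisc_pos hΦ hP hQ
  obtain ⟨hint', hval'⟩ := integrableOn_weightedPairKernel_quadDisc_neg hΦ hP hQ
  rw [← setIntegral_univ, ← setIntegral_congr_set quadDisc_pos_union_neg_ae_eq_univ,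
    setIntegral_union hdisj (continuous_quadDisc.measurable measurableSet_Iio) hint hint',
    hval, hval', skewForm]

end SkewFormIntegral

section RealMoment

variable {Φ : ℂ[X] → ℝ} {s : ℂ} {J : ℕ}

theorem monicPoly_eq_map_toMonic (N : ℕ) (b : Fin N → ℝ) :
    monicPoly N b = (toMonic (b ∘ Fin.rev)).map (algebraMap ℝ ℂ) := by
  rw [map_toMonic, monicPoly, toMonic, polyOfCoeffs_apply, ← Equiv.sum_comp Fin.revPerm]
  refine congrArg (X ^ N + ·) (Finset.sum_congr rfl fun i _ => ?_)
  have hexp : N - ((Fin.rev i : ℕ) + 1) = i := by rw [Fin.val_rev]; omega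
  rw [Fin.revPerm_apply, hexp, Function.comp_apply, Function.comp_apply, Complex.coe_algebraMap]

theorem momentIntegrand_eq (Φ : ℂ[X] → ℝ) (N : ℕ) (s : ℂ) :
    momentIntegrand Φ N s = (fun c => polyWeight Φ s ((toMonic c).map (algebraMap ℝ ℂ))) ∘
      MeasurableEquiv.piCongrLeft (fun _ : Fin N => ℝ) Fin.revPerm := by
  ext b
  have hrev : MeasurableEquiv.piCongrLeft (fun _ : Fin N => ℝ) Fin.revPerm b = b ∘ Fin.rev := by
    ext i
    obtain ⟨j, rfl⟩ := Fin.revPerm.surjective i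
    rw [MeasurableEquiv.coe_piCongrLeft, Equiv.piCongrLeft_apply_apply, Function.comp_apply,
      Fin.revPerm_apply, Fin.rev_rev]
  rw [momentIntegrand, Function.comp_apply, hrev, monicPoly_eq_map_toMonic, polyWeight]

theorem integrable_momentIntegrand (hΦ : IsMultiplicativeDistanceFunction Φ) {N : ℕ}
    (hs : (N : ℝ) < s.re) : Integrable (momentIntegrand Φ N s) := by
  rw [momentIntegrand_eq]
  exact ((volume_measurePreserving_piCongrLeft (fun _ => ℝ) Fin.revPerm).integrable_comp_emb
    (MeasurableEquiv.measurableEmbedding _)).2 (hΦ.integrable_polyWeight_map_toMonic hs)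

theorem realMoment_eq (Φ : ℂ[X] → ℝ) (N : ℕ) (s : ℂ) :
    realMoment Φ N s = ∫ c : Fin N → ℝ, polyWeight Φ s ((toMonic c).map (algebraMap ℝ ℂ)) := by
  rw [realMoment, momentIntegrand_eq]
  exact (volume_measurePreserving_piCongrLeft (fun _ => ℝ) Fin.revPerm).integral_comp
    (MeasurableEquiv.measurableEmbedding _)
    fun c => polyWeight Φ s ((toMonic c).map (algebraMap ℝ ℂ))

theorem factorial_mul_realMoment (hΦ : IsMultiplicativeDistanceFunction Φ)
    (hs : ((2 * J : ℕ) : ℝ) < s.re) :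
    J.factorial * realMoment Φ (2 * J) s = ∫ q : Fin J → Fin 2 → ℝ,
      (resultantProd q : ℂ) * ∏ k, polyWeight Φ s ((toMonic (q k)).map (algebraMap ℝ ℂ)) := by
  rw [realMoment_eq, ← integral_resultantProd_mul
    (f := fun p => polyWeight Φ s (p.map (algebraMap ℝ ℂ)))
    (hΦ.continuous_polyWeight_map_toMonic s (2 * J)).measurable
    (hΦ.integrable_polyWeight_map_toMonic hs)]
  simp only [Polynomial.map_prod, hΦ.polyWeight_prod]

variable {Q : Fin (2 * J) → ℂ[X]}

theorem ae_two_pow_mul_resultantProd_mul (hQ : IsCompleteMonicFamily Q) (Φ : ℂ[X] → ℝ) (s : ℂ) :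
    ∀ᵐ q : Fin J → Fin 2 → ℝ, 2 ^ J * ((resultantProd q : ℂ) *
        ∏ k, polyWeight Φ s ((toMonic (q k)).map (algebraMap ℝ ℂ))) =
      ∑ σ : Equiv.Perm (Fin J × Fin 2), ((Equiv.Perm.sign σ : ℤ) : ℂ) * ∏ k,
        weightedPairKernel Φ s (Q (pairIndex J (σ (k, 0)))) (Q (pairIndex J (σ (k, 1)))) (q k) := by
  have hae : ∀ᵐ q : Fin J → Fin 2 → ℝ, ∀ k, quadDisc (q k) ≠ 0 :=
    ae_all_iff.2 fun k => (Measure.quasiMeasurePreserving_eval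
      (fun _ : Fin J => (volume : Measure (Fin 2 → ℝ))) k).ae ae_quadDisc_ne_zero
  filter_upwards [hae] with q hq
  rw [← mul_assoc, two_pow_mul_resultantProd hQ hq, Finset.sum_mul]
  refine Finset.sum_congr rfl fun σ _ => ?_
  simp only [weightedPairKernel, Finset.prod_mul_distrib]
  ring

theorem two_pow_mul_factorial_mul_realMoment (hΦ : IsMultiplicativeDistanceFunction Φ)
    (hs : ((2 * J : ℕ) : ℝ) < s.re) (hQ : IsCompleteMonicFamily Q) :
    2 ^ J * J.factorial * realMoment Φ (2 * J) s =
      ∑ σ : Equiv.Perm (Fin J × Fin 2), ((Equiv.Perm.sign σ : ℤ) : ℂ) *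
        ∏ k, skewForm Φ s (Q (pairIndex J (σ (k, 0)))) (Q (pairIndex J (σ (k, 1)))) := by
  have hdeg : ∀ i, ((Q i).natDegree : ℝ) + 1 < s.re := by
    intro i
    rw [(hQ i).2]
    exact lt_of_le_of_lt (mod_cast i.2) hs
  rw [mul_assoc, factorial_mul_realMoment hΦ hs, ← integral_const_mul,
    integral_congr_ae (ae_two_pow_mul_resultantProd_mul hQ Φ s), integral_finsetSum]
  swap
  · exact fun σ _ => (Integrable.fintype_prod fun k =>
      integrable_weightedPairKernel hΦ (hdeg _) (hdeg _)).const_mul _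
  refine Finset.sum_congr rfl fun σ _ => ?_
  rw [integral_const_mul, integral_fintype_prod_volume_eq_prod fun k => weightedPairKernel Φ s
    (Q (pairIndex J (σ (k, 0)))) (Q (pairIndex J (σ (k, 1))))]
  simp only [integral_weightedPairKernel hΦ (hdeg _) (hdeg _)]

end RealMoment

theorem corollary2 (Φ : ℂ[X] → ℝ) (hΦ : IsMultiplicativeDistanceFunction Φ)
    (J : ℕ) (s : ℂ) (hs : ((2 * J : ℕ) : ℝ) < s.re)
    (Q : Fin (2 * J) → ℂ[X]) (hQ : IsCompleteMonicFamily Q)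
    (M : Fin J → ℂ) (hQM : IsSkewOrthogonal Φ s Q M) :
    Integrable (momentIntegrand Φ (2 * J) s) volume ∧
      realMoment Φ (2 * J) s = ∏ j : Fin J, M j := by
  refine ⟨integrable_momentIntegrand hΦ hs, ?_⟩
  have hsum := sum_perm_sign_mul_prod_skew_block (M := M)
    (B := fun a b => skewForm Φ s (Q (pairIndex J a)) (Q (pairIndex J b)))
    (fun i j => by simp only [pairIndex_fst, pairIndex_snd, hQM.fst_snd])
    (fun i j => by simp only [pairIndex_fst, pairIndex_snd, ← hQM.snd_fst, neg_neg])
    (fun i j => by simp only [pairIndex_fst, hQM.fst_fst])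
    (fun i j => by simp only [pairIndex_snd, hQM.snd_snd])
  rw [← two_pow_mul_factorial_mul_realMoment hΦ hs hQ, Fintype.card_fin] at hsum
  have hne : (2 ^ J * J.factorial : ℂ) ≠ 0 :=
    mul_ne_zero (pow_ne_zero J two_ne_zero) (Nat.cast_ne_zero.2 J.factorial_ne_zero)
  exact mul_left_cancel₀ hne hsum
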